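/- Let $n\ge 3$. Let $W(B_n)$ be the group of signed permutations, that is of the bijections $w$ of $\{\pm1,\dots,\pm n\}$ with $w(-i)=-w(i)$ for all $i$, with the simple reflections $s_i=(i\;\,i{+}1)(-i\;\,-(i{+}1))$ for $1\le i<n$ and $s_n=(n\;\,-n)$. Let $T$ be the set of all conjugates of the simple reflections, let $\ell(w)$ be the least length of a word in $T$ with product $w$, and let $v\le w$ mean $\ell(w)=\ell(v)+\ell(v^{-1}w)$ (the absolute order). Let $c$ be a Coxeter element, that is a conjugate of a product of all the simple reflections $s_1,\dots,s_n$, each taken once, in some order, for instance the $2n$-cycle $c=(1\;2\cdots n\;\,{-1}\;{-2}\cdots{-n})$. Let $\mathrm{NC}(B_n)=\{w\in W(B_n): w\le c\}$, ordered by $\le$, and let $\mathrm{Aut}(\mathrm{NC}(B_n))$ be the group of its lattice automorphisms, that is of the bijections $\varphi$ of $\mathrm{NC}(B_n)$ onto itself such that $\varphi$ and $\varphi^{-1}$ preserve the order. A bipartition of $c$ is a factorization $c=lr$ in $W(B_n)$ with $l^2=r^2=1$. Then the following hold. 1. The element $c$ has a bipartition. For every bipartition $c=lr$, the maps $\varphi_l(w)=l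 w^{-1} l$ and $\varphi_r(w)=r w^{-1} r$ are lattice automorphisms of $\mathrm{NC}(B_n)$ and generate $\mathrm{Aut}(\mathrm{NC}(B_n))$. This group is isomorphic to the dihedral group of order $2n$ (the symmetry group of the regular $n$-gon), by an isomorphism that takes $\varphi_l$ and $\varphi_r$ to two reflections whose product is a rotation by $2\pi/n$. In particular $|\mathrm{Aut}(\mathrm{NC}(B_n))|=2n$. 2. The vertices of the regular $2n$-gon can be labelled bijectively by $\{\pm1,\dots,\pm n\}$ so that $c$ takes the label of each vertex to the label of the cyclically next vertex. For every such labelling, there is a surjective homomorphism $\rho$ from the symmetry group of the $2n$-gon (of order $4n$) onto $\mathrm{Aut}(\mathrm{NC}(B_n))$, whose kernel consists of the identity and the rotation by $180^\circ$, such that for every symmetry $g$ and every $w\in\mathrm{NC}(B_n)$ the partition of the vertices into the cycles of $\rho(g)(w)$ is the image under $g$ of the partition of the vertices into the cycles of $w$. -/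

import Mathlib

namespace TypeB

/-- The set `{±1, …, ±n}`: the pair `(i, ε)` stands for `ε · (i + 1)`. -/
abbrev SignedIndex (n : ℕ) : Type := Fin n × ℤˣ

/-- The sign change `x ↦ -x` on `{±1, …, ±n}`. -/
def flip {n : ℕ} (x : SignedIndex n) : SignedIndex n := (x.1, -x.2)

/-- The signed permutations: the bijections `w` of `{±1, …, ±n}` with `w (-x) = - w x`. -/
def signedPerms (n : ℕ) : Subgroup (Equiv.Perm (SignedIndex n)) where
  carrier := {w | ∀ x, w (flip x) = flip (w x)}
  mul_mem' := by
    intro a b ha hb x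
    rw [Equiv.Perm.mul_apply, Equiv.Perm.mul_apply, hb, ha]
  one_mem' := by
    intro x
    rfl
  inv_mem' := by
    intro a ha x
    rw [Equiv.Perm.inv_eq_iff_eq, ha, Equiv.Perm.coe_inv, Equiv.apply_symm_apply]

/-- The Coxeter group of type `B_n`, that is the signed symmetric group. -/
abbrev W (n : ℕ) : Type := ↥(signedPerms n)

/-- The paired transposition `((i j)) = (i j)(-i -j)` for positive `i`, `j`. -/
def pairedSwap {n : ℕ} (i j : Fin n) : W n :=
  ⟨Equiv.prodCongr (Equiv.swap i j) (Equiv.refl ℤˣ), fun _ => rfl⟩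

/-- The balanced transposition `[i] = (i -i)`. -/
def signSwap {n : ℕ} (i : Fin n) : W n :=
  ⟨Equiv.swap (i, 1) (i, -1), by
    rintro ⟨k, e⟩
    by_cases h : k = i
    · subst h
      rcases Int.units_eq_one_or e with rfl | rfl <;> simp [flip]
    · rw [Equiv.swap_apply_of_ne_of_ne (a := (i, 1)) (b := (i, -1)) (x := (k, e)) (by simp [h])
        (by simp [h]), Equiv.swap_apply_of_ne_of_ne (by simp [flip, h]) (by simp [flip, h])]⟩

/-- The simple reflections, indexed from `0`: `((1 2)), ((2 3)), …, ((n-1 n)), [n]`. -/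
def simple {n : ℕ} (i : Fin n) : W n :=
  if h : (i : ℕ) + 1 < n then pairedSwap i ⟨i + 1, h⟩ else signSwap i

/-- The reflections: the conjugates of the simple reflections. -/
def reflections (n : ℕ) : Set (W n) := {t | ∃ (w : W n) (i : Fin n), t = w * simple i * w⁻¹}

/-- The absolute length: the least length of a word in the reflections that represents `w`. -/
noncomputable def absLength {n : ℕ} (w : W n) : ℕ :=
  sInf {k | ∃ L : List (W n), (∀ t ∈ L, t ∈ reflections n) ∧ L.prod = w ∧ L.length = k}

/-- The absolute order on `W n`. -/
def AbsLE {n : ℕ} (v w : W n) : Prop := absLength w = absLength v + absLength (v⁻¹ * w)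

/-- A Coxeter element: a conjugate of a product of all simple reflections in some order. -/
def IsCoxeterElement {n : ℕ} (c : W n) : Prop :=
  ∃ (σ : Equiv.Perm (Fin n)) (g : W n),
    c = g * (List.ofFn fun i => simple (σ i)).prod * g⁻¹

/-- The non-crossing partitions `NC(B_n)` with respect to `c`: all `w ≤ c`. -/
def NC {n : ℕ} (c : W n) : Type := {w : W n // AbsLE w c}

/-- `NC c` carries the absolute order. -/
instance {n : ℕ} (c : W n) : LE (NC c) := ⟨fun v w => AbsLE v.1 w.1⟩

/-- `c = l r` is a bipartition of `c`. -/
def IsBipartition {n : ℕ} (c l r : W n) : Prop := c = l * r ∧ l ^ 2 = 1 ∧ r ^ 2 = 1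

/-- The symmetries of the regular `m`-gon acting on its vertices, which are numbered cyclically
by `ZMod m`: the rotations `k ↦ k + i` and the reflections `k ↦ -(k + i)`. -/
def polygonAct {m : ℕ} : DihedralGroup m → ZMod m → ZMod m
  | DihedralGroup.r i, k => k + i
  | DihedralGroup.sr i, k => -(k + i)

/-- A labelling of the vertices of the `2n`-gon by `{±1, …, ±n}` in the cyclic order given by `c`.
For `c = [1 … n]` the labels in cyclic order are `1, …, n, -1, …, -n`. -/
def IsPolygonLabelling {n : ℕ} (c : W n) (f : ZMod (2 * n) ≃ SignedIndex n) : Prop :=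
  ∀ k, f (k + 1) = c.1 (f k)

/-- The vertices `x` and `y` of the `2n`-gon lie in the same block of the picture of `w`: the
blocks of `w` are the (possibly trivial) cycles of the permutation `w`. -/
def SameBlock {n : ℕ} (f : ZMod (2 * n) ≃ SignedIndex n) (w : W n) (x y : ZMod (2 * n)) : Prop :=
  w.1.SameCycle (f x) (f y)

end TypeB

/-!
In the reflection representation, the absolute length of a signed permutation is the dimension of
its moved space (Carter), and an element `w ≤ c` is determined by its moved space (Brady–Watt), so
that the order on `NC(B_n)` is inclusion of moved spaces. The atoms are the reflections, that is the
chords of the `2n`-gon up to the half turn. An automorphism preserves which pairs and triples of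
atoms have a common upper bound of rank two. The edges of the polygon are exactly the atoms that
have one with every atom. Two adjacent edges have one together with a third atom, whereas the plane
spanned by two disjoint edges contains no third root. An automorphism therefore acts on the `n ≥ 3`
edges as a rotation or a reflection. One that fixes all edges fixes all diagonals, inductively,
because each closes a triangle with a shorter diagonal and an edge, then all diameters, and hence
all of `NC(B_n)`. Conjugation by the symmetries of the polygon, composed with inversion for the
reflections, provides enough automorphisms, and only the half turn acts trivially.
-/

namespace TypeB

open Module

section OrthogonalGroup

variable {V : Type*} [NormedAddCommGroup V] [InnerProductSpace ℝ V]

/-- The linear map `A - 1`. -/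
def subOne (A : V ≃ₗᵢ[ℝ] V) : V →ₗ[ℝ] V := A.toLinearEquiv.toLinearMap - LinearMap.id

/-- The fixed space `ker (A - 1)`. -/
def fixSpace (A : V ≃ₗᵢ[ℝ] V) : Submodule ℝ V := LinearMap.ker (subOne A)

/-- The moved space `range (A - 1)`, the orthogonal complement of the fixed space. -/
def movSpace (A : V ≃ₗᵢ[ℝ] V) : Submodule ℝ V := LinearMap.range (subOne A)

/-- The dimension of the moved space. It is the reflection length of `A` in the orthogonal
group. -/
noncomputable def movRank (A : V ≃ₗᵢ[ℝ] V) : ℕ := finrank ℝ (movSpace A)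

/-- The orthogonal reflection with root `a`, with the junk value `1` at `a = 0`. -/
noncomputable def rootReflection (a : V) : V ≃ₗᵢ[ℝ] V := (ℝ ∙ a)ᗮ.reflection

/-- The absolute order on the orthogonal group. -/
def OrthLE (A B : V ≃ₗᵢ[ℝ] V) : Prop := movRank B = movRank A + movRank (A⁻¹ * B)

theorem isometry_mul_apply (A B : V ≃ₗᵢ[ℝ] V) (v : V) : (A * B) v = A (B v) := rfl

theorem isometry_apply_inv (A : V ≃ₗᵢ[ℝ] V) (v : V) : A (A⁻¹ v) = v := A.apply_symm_apply v

theorem isometry_inv_apply (A : V ≃ₗᵢ[ℝ] V) (v : V) : A⁻¹ (A v) = v := A.symm_apply_apply v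

theorem mem_fixSpace {A : V ≃ₗᵢ[ℝ] V} {v : V} : v ∈ fixSpace A ↔ A v = v := by
  simp [fixSpace, subOne, sub_eq_zero]

theorem mem_fixSpace_inv_mul {A C : V ≃ₗᵢ[ℝ] V} {v : V} :
    v ∈ fixSpace (A⁻¹ * C) ↔ C v = A v := by
  rw [mem_fixSpace, isometry_mul_apply, ← A.injective.eq_iff, isometry_apply_inv]

theorem mem_movSpace {A : V ≃ₗᵢ[ℝ] V} {v : V} : v ∈ movSpace A ↔ ∃ u, A u - u = v := by
  simp [movSpace, subOne]

theorem sub_mem_movSpace (A : V ≃ₗᵢ[ℝ] V) (v : V) : A v - v ∈ movSpace A :=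
  mem_movSpace.2 ⟨v, rfl⟩

theorem movSpace_one : movSpace (1 : V ≃ₗᵢ[ℝ] V) = ⊥ := by
  rw [eq_bot_iff]
  intro v hv
  obtain ⟨u, rfl⟩ := mem_movSpace.1 hv
  simp

theorem movRank_one : movRank (1 : V ≃ₗᵢ[ℝ] V) = 0 := by
  rw [movRank, movSpace_one, finrank_bot]

theorem movSpace_inv (A : V ≃ₗᵢ[ℝ] V) : movSpace A⁻¹ = movSpace A := by
  ext v
  simp only [mem_movSpace]
  constructor
  · rintro ⟨u, rfl⟩
    exact ⟨-A⁻¹ u, by rw [map_neg, isometry_apply_inv, sub_neg_eq_add, neg_add_eq_sub]⟩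
  · rintro ⟨u, rfl⟩
    exact ⟨-A u, by rw [map_neg, isometry_inv_apply, sub_neg_eq_add, neg_add_eq_sub]⟩

theorem movRank_inv (A : V ≃ₗᵢ[ℝ] V) : movRank A⁻¹ = movRank A := by
  rw [movRank, movRank, movSpace_inv]

theorem movSpace_conj (A B : V ≃ₗᵢ[ℝ] V) :
    movSpace (B * A * B⁻¹) = (movSpace A).map B.toLinearEquiv.toLinearMap := by
  ext v
  simp only [Submodule.mem_map, mem_movSpace]
  constructor
  · rintro ⟨u, rfl⟩
    exact ⟨_, ⟨B⁻¹ u, rfl⟩, by simp [isometry_mul_apply]⟩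
  · rintro ⟨_, ⟨u, rfl⟩, rfl⟩
    exact ⟨B u, by simp [isometry_mul_apply, isometry_inv_apply]⟩

theorem movRank_conj (A B : V ≃ₗᵢ[ℝ] V) : movRank (B * A * B⁻¹) = movRank A := by
  rw [movRank, movSpace_conj]
  exact LinearEquiv.finrank_map_eq B.toLinearEquiv _

theorem movSpace_mul_le (A B : V ≃ₗᵢ[ℝ] V) : movSpace (A * B) ≤ movSpace A ⊔ movSpace B := by
  intro v hv
  obtain ⟨u, rfl⟩ := mem_movSpace.1 hv
  rw [isometry_mul_apply, ← sub_add_sub_cancel]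
  exact Submodule.add_mem_sup (sub_mem_movSpace A _) (sub_mem_movSpace B _)

theorem fixSpace_eq_orthogonal (A : V ≃ₗᵢ[ℝ] V) : fixSpace A = (movSpace A)ᗮ := by
  ext v
  have hinner (u : V) : inner ℝ (A u - u) v = inner ℝ (A u) (v - A v) := by
    rw [inner_sub_left, inner_sub_right, A.inner_map_map]
  rw [mem_fixSpace, Submodule.mem_orthogonal]
  constructor
  · rintro hv w hw
    obtain ⟨u, rfl⟩ := mem_movSpace.1 hw
    rw [hinner, hv, sub_self, inner_zero_right]
  · intro h
    refine (sub_eq_zero.1 (ext_inner_left ℝ fun w => ?_)).symm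
    rw [← isometry_apply_inv A w, ← hinner, h _ (sub_mem_movSpace A _), inner_zero_right]

theorem inner_apply_sub (A : V ≃ₗᵢ[ℝ] V) (x y : V) :
    inner ℝ x (A y - y) = -inner ℝ (A x - x) (A y) := by
  rw [inner_sub_right, inner_sub_left, A.inner_map_map, neg_sub]

theorem rootReflection_mul_self (a : V) : rootReflection a * rootReflection a = 1 :=
  (ℝ ∙ a)ᗮ.reflection_mul_reflection

theorem rootReflection_inv (a : V) : (rootReflection a)⁻¹ = rootReflection a :=
  (ℝ ∙ a)ᗮ.reflection_inv

theorem rootReflection_apply_eq_self_iff {a v : V} :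
    rootReflection a v = v ↔ inner ℝ a v = 0 := by
  rw [rootReflection, Submodule.reflection_eq_self_iff,
    Submodule.mem_orthogonal_singleton_iff_inner_right]

section FiniteDimensional

variable [FiniteDimensional ℝ V]

theorem movSpace_eq_orthogonal (A : V ≃ₗᵢ[ℝ] V) : movSpace A = (fixSpace A)ᗮ := by
  rw [fixSpace_eq_orthogonal, Submodule.orthogonal_orthogonal]

theorem finrank_fixSpace_add_movRank (A : V ≃ₗᵢ[ℝ] V) :
    finrank ℝ (fixSpace A) + movRank A = finrank ℝ V := by
  rw [add_comm]
  exact LinearMap.finrank_range_add_finrank_ker (subOne A)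

theorem movRank_mul_le (A B : V ≃ₗᵢ[ℝ] V) : movRank (A * B) ≤ movRank A + movRank B :=
  (Submodule.finrank_mono (movSpace_mul_le A B)).trans
    (Submodule.finrank_add_le_finrank_add_finrank _ _)

theorem eq_one_of_movRank_eq_zero {A : V ≃ₗᵢ[ℝ] V} (h : movRank A = 0) : A = 1 := by
  ext v
  rw [movRank, Submodule.finrank_eq_zero] at h
  have hv := sub_mem_movSpace A v
  rwa [h, Submodule.mem_bot, sub_eq_zero] at hv

theorem movSpace_rootReflection (a : V) : movSpace (rootReflection a) = ℝ ∙ a := by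
  have hfix : fixSpace (rootReflection a) = (ℝ ∙ a)ᗮ := by
    ext v
    rw [mem_fixSpace, rootReflection, Submodule.reflection_eq_self_iff]
  rw [movSpace_eq_orthogonal, hfix, Submodule.orthogonal_orthogonal]

theorem movRank_rootReflection {a : V} (ha : a ≠ 0) : movRank (rootReflection a) = 1 := by
  rw [movRank, movSpace_rootReflection, finrank_span_singleton ha]

theorem movRank_rootReflection_mul_add_one {A : V ≃ₗᵢ[ℝ] V} {a : V} (ha : a ≠ 0)
    (h : a ∈ movSpace A) : movRank (rootReflection a * A) + 1 = movRank A := by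
  have hle : movRank A ≤ 1 + movRank (rootReflection a * A) := by
    have := movRank_mul_le (rootReflection a) (rootReflection a * A)
    rwa [← mul_assoc, rootReflection_mul_self, one_mul, movRank_rootReflection ha] at this
  have hlt : fixSpace A < fixSpace (rootReflection a * A) := by
    rw [SetLike.lt_iff_le_and_exists]
    refine ⟨fun v hv => ?_, ?_⟩
    · rw [mem_fixSpace, isometry_mul_apply, mem_fixSpace.1 hv, rootReflection_apply_eq_self_iff]
      rw [fixSpace_eq_orthogonal] at hv
      exact Submodule.inner_right_of_mem_orthogonal h hv
    · obtain ⟨u, rfl⟩ := mem_movSpace.1 h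
      refine ⟨u, ?_, fun hu => ha (sub_eq_zero.2 (mem_fixSpace.1 hu))⟩
      rw [mem_fixSpace, isometry_mul_apply]
      exact Submodule.reflection_sub (A.norm_map u)
  have hfinrank := Submodule.finrank_lt_finrank_of_lt hlt
  have hA := finrank_fixSpace_add_movRank A
  have haA := finrank_fixSpace_add_movRank (rootReflection a * A)
  omega

namespace OrthLE

variable {A B C : V ≃ₗᵢ[ℝ] V}

theorem movSpace_eq_sup (h : OrthLE A B) : movSpace B = movSpace A ⊔ movSpace (A⁻¹ * B) := by
  apply Submodule.eq_of_le_of_finrank_le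
  · simpa only [mul_inv_cancel_left] using movSpace_mul_le A (A⁻¹ * B)
  · exact (Submodule.finrank_add_le_finrank_add_finrank _ _).trans h.ge

theorem movSpace_le (h : OrthLE A B) : movSpace A ≤ movSpace B :=
  h.movSpace_eq_sup ▸ le_sup_left

theorem trans (hAB : OrthLE A B) (hBC : OrthLE B C) : OrthLE A C := by
  have h₁ := movRank_mul_le A (A⁻¹ * C)
  have h₂ := movRank_mul_le (A⁻¹ * B) (B⁻¹ * C)
  rw [mul_inv_cancel_left] at h₁
  rw [mul_assoc, mul_inv_cancel_left] at h₂
  unfold OrthLE at *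
  omega

theorem fixSpace_inv_mul (h : OrthLE A C) :
    fixSpace (A⁻¹ * C) = (movSpace A).comap (subOne C) := by
  set K := (movSpace A).comap (subOne C)
  have hle : fixSpace (A⁻¹ * C) ≤ K := by
    intro v hv
    have : subOne C v = A v - v := congrArg (· - v) (mem_fixSpace_inv_mul.1 hv)
    exact Submodule.mem_comap.2 (this ▸ sub_mem_movSpace A v)
  have hK : finrank ℝ K ≤ movRank A + finrank ℝ (fixSpace C) := by
    rw [← LinearMap.finrank_range_add_finrank_ker ((subOne C).domRestrict K)]
    refine add_le_add (Submodule.finrank_mono ?_) ?_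
    · rintro _ ⟨v, rfl⟩
      exact v.2
    · rw [← Submodule.finrank_map_subtype_eq]
      refine Submodule.finrank_mono ?_
      rintro _ ⟨v, hv, rfl⟩
      exact hv
  apply Submodule.eq_of_le_of_finrank_le hle
  have hC := finrank_fixSpace_add_movRank C
  have hAC := finrank_fixSpace_add_movRank (A⁻¹ * C)
  unfold OrthLE at h
  omega

theorem apply_eq_of_sub_mem (h : OrthLE A C) {v : V} (hv : C v - v ∈ movSpace A) :
    C v = A v := by
  rw [← mem_fixSpace_inv_mul, h.fixSpace_inv_mul]
  exact hv

-- `A` and `B` agree on `fixSpace (A⁻¹ * C)`, where both agree with `C`, and on `fixSpace B`.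
-- These two subspaces meet inside `fixSpace C`, so their sum is large.
theorem of_movSpace_le (hA : OrthLE A C) (hB : OrthLE B C) (h : movSpace A ≤ movSpace B) :
    OrthLE A B := by
  have hAC : fixSpace (A⁻¹ * C) ≤ fixSpace (B⁻¹ * C) := by
    rw [hA.fixSpace_inv_mul, hB.fixSpace_inv_mul]
    exact Submodule.comap_mono h
  have hfix : fixSpace B ≤ fixSpace A := by
    rw [fixSpace_eq_orthogonal, fixSpace_eq_orthogonal]
    exact Submodule.orthogonal_le h
  have hsup : fixSpace (A⁻¹ * C) ⊔ fixSpace B ≤ fixSpace (A⁻¹ * B) := by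
    refine sup_le (fun v hv => ?_) (fun v hv => ?_)
    · rw [mem_fixSpace_inv_mul, ← mem_fixSpace_inv_mul.1 (hAC hv), mem_fixSpace_inv_mul.1 hv]
    · rw [mem_fixSpace_inv_mul, mem_fixSpace.1 hv, mem_fixSpace.1 (hfix hv)]
  have hinf : fixSpace (A⁻¹ * C) ⊓ fixSpace B ≤ fixSpace C := by
    rintro v ⟨hv, hv'⟩
    rw [mem_fixSpace, mem_fixSpace_inv_mul.1 (hAC hv), mem_fixSpace.1 hv']
  have hdim := Submodule.finrank_sup_add_finrank_inf_eq (fixSpace (A⁻¹ * C)) (fixSpace B)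
  have hsup' := Submodule.finrank_mono hsup
  have hinf' := Submodule.finrank_mono hinf
  have hsub := movRank_mul_le A (A⁻¹ * B)
  have h₁ := finrank_fixSpace_add_movRank (A⁻¹ * C)
  have h₂ := finrank_fixSpace_add_movRank (A⁻¹ * B)
  have h₃ := finrank_fixSpace_add_movRank B
  have h₄ := finrank_fixSpace_add_movRank C
  rw [mul_inv_cancel_left] at hsub
  unfold OrthLE at *
  omega

theorem eq_of_movSpace_eq (hA : OrthLE A C) (hB : OrthLE B C) (h : movSpace A = movSpace B) :
    A = B := by
  have hAB := hA.of_movSpace_le hB h.le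
  rw [OrthLE, movRank, ← h, ← movRank, left_eq_add] at hAB
  exact inv_mul_eq_one.1 (eq_one_of_movRank_eq_zero hAB)

end OrthLE

theorem rootReflection_orthLE_iff {A : V ≃ₗᵢ[ℝ] V} {a : V} :
    OrthLE (rootReflection a) A ↔ a ∈ movSpace A := by
  constructor
  · intro h
    apply h.movSpace_le
    rw [movSpace_rootReflection]
    exact Submodule.mem_span_singleton_self a
  · intro h
    rcases eq_or_ne a 0 with rfl | ha
    · have hone : rootReflection (0 : V) = 1 := eq_one_of_movRank_eq_zero <| by
        rw [movRank, movSpace_rootReflection, Submodule.span_zero_singleton, finrank_bot]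
      rw [OrthLE, hone, movRank_one, inv_one, one_mul, zero_add]
    · rw [OrthLE, movRank_rootReflection ha, rootReflection_inv,
        ← movRank_rootReflection_mul_add_one ha h, add_comm]

theorem fixSpace_rootReflection_mul_le {A : V ≃ₗᵢ[ℝ] V} {u : V} :
    fixSpace (rootReflection (A u - u) * A) ≤ fixSpace A ⊔ ℝ ∙ u := by
  intro v hv
  have hAv : A v - v ∈ ℝ ∙ (A u - u) := by
    rw [← rootReflection_inv, mem_fixSpace_inv_mul] at hv
    rw [hv, ← movSpace_rootReflection]
    exact sub_mem_movSpace _ v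
  obtain ⟨r, hr⟩ := Submodule.mem_span_singleton.1 hAv
  have hfix : v - r • u ∈ fixSpace A := by
    rw [mem_fixSpace, ← sub_eq_zero, map_sub, map_smul, sub_sub_sub_comm, ← smul_sub, hr, sub_self]
  exact Submodule.mem_sup.2 ⟨_, hfix, _, Submodule.smul_mem _ r
    (Submodule.mem_span_singleton_self u), sub_add_cancel _ _⟩

theorem rootReflection_mul_orthLE {A : V ≃ₗᵢ[ℝ] V} {a b u : V} (ha : a ≠ 0) (hb : b ≠ 0)
    (hu : A u - u = a) (hbA : b ∈ movSpace A) (hub : inner ℝ u b = 0) :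
    OrthLE (rootReflection a * rootReflection b) A ∧
      movRank (rootReflection a * rootReflection b) = 2 := by
  have hb' : b ∈ movSpace (rootReflection a * A) := by
    rw [movSpace_eq_orthogonal, ← Submodule.span_singleton_le_iff_mem,
      Submodule.le_orthogonal_iff_le_orthogonal, ← hu]
    refine fixSpace_rootReflection_mul_le.trans (sup_le ?_ ?_)
    · rw [fixSpace_eq_orthogonal]
      exact Submodule.orthogonal_le ((Submodule.span_singleton_le_iff_mem _ _).2 hbA)
    · rwa [Submodule.span_singleton_le_iff_mem,
        Submodule.mem_orthogonal_singleton_iff_inner_left]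
  have h₁ := movRank_rootReflection_mul_add_one ha (hu ▸ sub_mem_movSpace A u)
  have h₂ := movRank_rootReflection_mul_add_one hb hb'
  have h₃ := movRank_mul_le (rootReflection a) (rootReflection b)
  have h₄ := movRank_mul_le (rootReflection a * rootReflection b)
    (rootReflection b * (rootReflection a * A))
  rw [movRank_rootReflection ha, movRank_rootReflection hb] at h₃
  have hcancel : rootReflection a * rootReflection b *
      (rootReflection b * (rootReflection a * A)) = A := by
    rw [← mul_assoc, mul_assoc (rootReflection a), rootReflection_mul_self, mul_one, ← mul_assoc,
      rootReflection_mul_self, one_mul]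
  rw [hcancel] at h₄
  rw [OrthLE, mul_inv_rev, rootReflection_inv, rootReflection_inv, mul_assoc]
  omega

end FiniteDimensional

end OrthogonalGroup

section SignedPermutations

variable {n : ℕ}

theorem flip_flip (x : SignedIndex n) : flip (flip x) = x := by simp [flip]

theorem flip_ne (x : SignedIndex n) : flip x ≠ x := by
  intro h
  have := congrArg Prod.snd h
  rcases Int.units_eq_one_or x.2 with h' | h' <;> simp [flip, h'] at this

theorem apply_flip (w : W n) (x : SignedIndex n) : w.1 (flip x) = flip (w.1 x) := w.2 x

theorem fst_eq_iff {x y : SignedIndex n} : x.1 = y.1 ↔ x = y ∨ x = flip y := by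
  constructor
  · intro h
    rcases Int.units_eq_one_or x.2 with hx | hx <;> rcases Int.units_eq_one_or y.2 with hy | hy <;>
      simp [flip, Prod.ext_iff, h, hx, hy]
  · rintro (rfl | rfl) <;> rfl

theorem fst_apply_ne {x y : SignedIndex n} (w : W n) (h : x.1 ≠ y.1) :
    (w.1 x).1 ≠ (w.1 y).1 := by
  rw [Ne, fst_eq_iff, not_or] at h ⊢
  rwa [← apply_flip, w.1.apply_eq_iff_eq, w.1.apply_eq_iff_eq]

/-- The reflection that exchanges `x` with `y` and `-x` with `-y`; the case `y = -x` gives the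
balanced transposition `[x]`. -/
def signedSwap (x y : SignedIndex n) : W n :=
  let swap (z : SignedIndex n) : SignedIndex n :=
    if z = x then y else if z = y then x else
      if z = flip x then flip y else if z = flip y then flip x else z
  have swap_involutive : Function.Involutive swap := fun z => by
    simp only [swap]
    split_ifs <;> grind [flip_flip, flip_ne]
  ⟨swap_involutive.toPerm swap, fun z => by
    change swap (flip z) = flip (swap z)
    simp only [swap]
    split_ifs <;> grind [flip_flip, flip_ne]⟩

theorem signedSwap_apply (x y z : SignedIndex n) : (signedSwap x y).1 z =
    if z = x then y else if z = y then x else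
      if z = flip x then flip y else if z = flip y then flip x else z := rfl

theorem signedSwap_apply_left (x y : SignedIndex n) : (signedSwap x y).1 x = y := if_pos rfl

theorem signedSwap_apply_right (x y : SignedIndex n) : (signedSwap x y).1 y = x := by
  rw [signedSwap_apply, if_pos rfl, ite_eq_right_iff]
  exact id

theorem signedSwap_apply_of_fst_ne {x y z : SignedIndex n} (hx : z.1 ≠ x.1) (hy : z.1 ≠ y.1) :
    (signedSwap x y).1 z = z := by
  rw [Ne, fst_eq_iff, not_or] at hx hy
  rw [signedSwap_apply, if_neg hx.1, if_neg hy.1, if_neg hx.2, if_neg hy.2]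

theorem eq_signedSwap {w : W n} {x y : SignedIndex n} (hx : w.1 x = y) (hy : w.1 y = x)
    (h : ∀ z, z.1 ≠ x.1 → z.1 ≠ y.1 → w.1 z = z) : w = signedSwap x y := by
  refine Subtype.ext (Equiv.ext fun z => ?_)
  by_cases hzx : z.1 = x.1
  · rcases fst_eq_iff.1 hzx with rfl | rfl
    · rw [hx, signedSwap_apply_left]
    · rw [apply_flip, apply_flip, hx, signedSwap_apply_left]
  by_cases hzy : z.1 = y.1
  · rcases fst_eq_iff.1 hzy with rfl | rfl
    · rw [hy, signedSwap_apply_right]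
    · rw [apply_flip, apply_flip, hy, signedSwap_apply_right]
  rw [h z hzx hzy, signedSwap_apply_of_fst_ne hzx hzy]

theorem signedSwap_mul_self (x y : SignedIndex n) : signedSwap x y * signedSwap x y = 1 :=
  Subtype.ext (Equiv.ext (signedSwap x y).1.left_inv)

theorem signedSwap_inv (x y : SignedIndex n) : (signedSwap x y)⁻¹ = signedSwap x y :=
  inv_eq_of_mul_eq_one_right (signedSwap_mul_self x y)

theorem conj_signedSwap (w : W n) (x y : SignedIndex n) :
    w * signedSwap x y * w⁻¹ = signedSwap (w.1 x) (w.1 y) := by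
  have happly (z : SignedIndex n) :
      (w * signedSwap x y * w⁻¹).1 (w.1 z) = w.1 ((signedSwap x y).1 z) :=
    congrArg (fun z => w.1 ((signedSwap x y).1 z)) (w.1.symm_apply_apply z)
  apply eq_signedSwap
  · rw [happly, signedSwap_apply_left]
  · rw [happly, signedSwap_apply_right]
  · intro z hzx hzy
    obtain ⟨z, rfl⟩ := w.1.surjective z
    rw [happly, signedSwap_apply_of_fst_ne (mt (fun h => ?_) hzx) (mt (fun h => ?_) hzy)]
    all_goals
      rw [fst_eq_iff] at h ⊢
      exact h.imp (congrArg w.1) fun h => by rw [h, apply_flip]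

theorem simple_of_lt {i : Fin n} (h : (i : ℕ) + 1 < n) :
    simple i = signedSwap (i, 1) (⟨i + 1, h⟩, 1) := by
  rw [simple, dif_pos h]
  apply eq_signedSwap
  · simp [pairedSwap]
  · simp [pairedSwap]
  · intro z hi hj
    exact Prod.ext (Equiv.swap_apply_of_ne_of_ne hi hj) rfl

theorem simple_of_not_lt {i : Fin n} (h : ¬(i : ℕ) + 1 < n) :
    simple i = signedSwap (i, 1) (i, -1) := by
  rw [simple, dif_neg h]
  apply eq_signedSwap
  · simp [signSwap]
  · simp [signSwap]
  · intro z hi _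
    exact Equiv.swap_apply_of_ne_of_ne (fun h => hi (h ▸ rfl)) (fun h => hi (h ▸ rfl))

theorem signedSwap_apply_mem_reflections (w : W n) {x y : SignedIndex n} {i : Fin n}
    (h : simple i = signedSwap x y) : signedSwap (w.1 x) (w.1 y) ∈ reflections n :=
  ⟨w, i, by rw [h, conj_signedSwap]⟩

theorem signedSwap_flip_mem_reflections (x : SignedIndex n) :
    signedSwap x (flip x) ∈ reflections n := by
  let last : Fin n := ⟨n - 1, by have := x.1.pos; omega⟩
  have h := signedSwap_apply_mem_reflections (signedSwap (last, 1) x)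
    (simple_of_not_lt (i := last) (by simp only [last]; omega))
  rwa [show (last, -1) = flip (last, 1) from rfl, apply_flip, signedSwap_apply_left] at h

theorem signedSwap_mem_reflections_of_fst_ne {x y : SignedIndex n} (hxy : x.1 ≠ y.1) :
    signedSwap x y ∈ reflections n := by
  have hn : 0 + 1 < n := by
    have := Fin.val_ne_of_ne hxy
    omega
  let a : SignedIndex n := (⟨0, by omega⟩, 1)
  let b : SignedIndex n := (⟨0 + 1, hn⟩, 1)
  let y' := (signedSwap a x).1 b
  have hxy' : x.1 ≠ y'.1 := by
    have := fst_apply_ne (signedSwap a x) (x := a) (y := b) (by simp [a, b])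
    rwa [signedSwap_apply_left] at this
  have h := signedSwap_apply_mem_reflections (signedSwap y' y * signedSwap a x)
    (simple_of_lt (i := ⟨0, by omega⟩) hn)
  have hx : (signedSwap y' y * signedSwap a x).1 a = x :=
    (congrArg _ (signedSwap_apply_left a x)).trans (signedSwap_apply_of_fst_ne hxy' hxy)
  have hy : (signedSwap y' y * signedSwap a x).1 b = y := signedSwap_apply_left y' y
  rwa [hx, hy] at h

theorem mem_reflections_iff {t : W n} :
    t ∈ reflections n ↔ ∃ x y : SignedIndex n, x ≠ y ∧ t = signedSwap x y := by
  constructor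
  · rintro ⟨w, i, rfl⟩
    by_cases h : (i : ℕ) + 1 < n
    · rw [simple_of_lt h, conj_signedSwap]
      exact ⟨_, _, w.1.injective.ne (by simp [Fin.ext_iff]), rfl⟩
    · rw [simple_of_not_lt h, conj_signedSwap]
      exact ⟨_, _, w.1.injective.ne (by simp), rfl⟩
  · rintro ⟨x, y, hxy, rfl⟩
    by_cases h : x.1 = y.1
    · rcases fst_eq_iff.1 h.symm with rfl | rfl
      · exact absurd rfl hxy
      · exact signedSwap_flip_mem_reflections x
    · exact signedSwap_mem_reflections_of_fst_ne h

end SignedPermutations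

section ReflectionRepresentation

variable {n : ℕ}

/-- The signed coordinate vector `± e_i`. -/
noncomputable def signedVec (x : SignedIndex n) : EuclideanSpace ℝ (Fin n) :=
  ((x.2 : ℤ) : ℝ) • EuclideanSpace.basisFun (Fin n) ℝ x.1

theorem signedVec_flip (x : SignedIndex n) : signedVec (flip x) = -signedVec x := by
  simp [signedVec, flip]

theorem inner_signedVec_self (x : SignedIndex n) : inner ℝ (signedVec x) (signedVec x) = 1 := by
  rcases Int.units_eq_one_or x.2 with h | h <;> simp [signedVec, h]

theorem norm_signedVec (x : SignedIndex n) : ‖signedVec x‖ = 1 := by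
  rw [norm_eq_sqrt_real_inner, inner_signedVec_self, Real.sqrt_one]

theorem inner_signedVec_of_fst_ne {x y : SignedIndex n} (h : x.1 ≠ y.1) :
    inner ℝ (signedVec x) (signedVec y) = 0 := by
  rw [signedVec, signedVec, inner_smul_left, inner_smul_right,
    (EuclideanSpace.basisFun (Fin n) ℝ).orthonormal.2 h, mul_zero, mul_zero]

theorem signedVec_injective : Function.Injective (signedVec (n := n)) := by
  intro x y h
  have hinner : inner ℝ (signedVec x) (signedVec y) = 1 := by rw [h, inner_signedVec_self]
  by_cases hfst : x.1 = y.1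
  · refine (fst_eq_iff.1 hfst).resolve_right ?_
    rintro rfl
    rw [signedVec_flip, inner_neg_left, inner_signedVec_self] at hinner
    norm_num at hinner
  · exact absurd (inner_signedVec_of_fst_ne hfst) (hinner ▸ one_ne_zero)

theorem signedVec_sub_ne_zero {x y : SignedIndex n} (h : x ≠ y) :
    signedVec x - signedVec y ≠ 0 := sub_ne_zero.2 (signedVec_injective.ne h)

theorem orthonormal_signedVec (w : W n) :
    Orthonormal ℝ fun i : Fin n => signedVec (w.1 (i, 1)) :=
  ⟨fun _ => norm_signedVec _, fun _ _ h => inner_signedVec_of_fst_ne (fst_apply_ne w h)⟩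

/-- The image of the standard basis under a signed permutation. -/
noncomputable def signedBasis (w : W n) : OrthonormalBasis (Fin n) ℝ (EuclideanSpace ℝ (Fin n)) :=
  OrthonormalBasis.mk (orthonormal_signedVec w)
    ((orthonormal_signedVec w).linearIndependent.span_eq_top_of_card_eq_finrank' (by simp)).ge

/-- The isometry of `ℝⁿ` that permutes the signed coordinate vectors as `w` does. -/
noncomputable def toIsometry (w : W n) :
    EuclideanSpace ℝ (Fin n) ≃ₗᵢ[ℝ] EuclideanSpace ℝ (Fin n) :=
  (EuclideanSpace.basisFun (Fin n) ℝ).equiv (signedBasis w) (Equiv.refl _)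

theorem toIsometry_signedVec (w : W n) (x : SignedIndex n) :
    toIsometry w (signedVec x) = signedVec (w.1 x) := by
  have hpos (i : Fin n) : toIsometry w (signedVec (i, 1)) = signedVec (w.1 (i, 1)) := by
    have : signedVec (i, (1 : ℤˣ)) = EuclideanSpace.basisFun (Fin n) ℝ i := by simp [signedVec]
    rw [this, toIsometry, OrthonormalBasis.equiv_apply_basis]
    simp [signedBasis]
  rcases fst_eq_iff.1 (show x.1 = ((x.1, 1) : SignedIndex n).1 from rfl) with h | h
  · rw [h, hpos]
  · rw [h, apply_flip, signedVec_flip, signedVec_flip, map_neg, hpos]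

theorem isometry_ext {A B : EuclideanSpace ℝ (Fin n) ≃ₗᵢ[ℝ] EuclideanSpace ℝ (Fin n)}
    (h : ∀ x, A (signedVec x) = B (signedVec x)) : A = B := by
  apply LinearIsometryEquiv.toLinearEquiv_injective
  apply (EuclideanSpace.basisFun (Fin n) ℝ).toBasis.ext'
  intro i
  simpa [signedVec] using h (i, 1)

/-- The reflection representation of `W n`. -/
noncomputable def rep : W n →* (EuclideanSpace ℝ (Fin n) ≃ₗᵢ[ℝ] EuclideanSpace ℝ (Fin n)) where
  toFun := toIsometry
  map_one' := isometry_ext fun x => toIsometry_signedVec 1 x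
  map_mul' v w := isometry_ext fun x => by
    rw [isometry_mul_apply, toIsometry_signedVec, toIsometry_signedVec, toIsometry_signedVec]
    rfl

theorem rep_signedVec (w : W n) (x : SignedIndex n) :
    rep w (signedVec x) = signedVec (w.1 x) := toIsometry_signedVec w x

theorem rep_injective : Function.Injective (rep (n := n)) := by
  intro v w h
  refine Subtype.ext (Equiv.ext fun x => signedVec_injective ?_)
  rw [← rep_signedVec, ← rep_signedVec, h]

theorem rootReflection_signedVec_sub_left (x y : SignedIndex n) :
    rootReflection (signedVec x - signedVec y) (signedVec x) = signedVec y :=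
  Submodule.reflection_sub ((norm_signedVec x).trans (norm_signedVec y).symm)

theorem rootReflection_signedVec_sub_right (x y : SignedIndex n) :
    rootReflection (signedVec x - signedVec y) (signedVec y) = signedVec x :=
  (congrArg _ (rootReflection_signedVec_sub_left x y)).symm.trans
    (Submodule.reflection_reflection _ _)

theorem rep_signedSwap (x y : SignedIndex n) :
    rep (signedSwap x y) = rootReflection (signedVec x - signedVec y) := by
  refine isometry_ext fun z => ?_
  by_cases hzx : z.1 = x.1
  · rcases fst_eq_iff.1 hzx with rfl | rfl <;>
      simp only [signedVec_flip, map_neg, rep_signedVec, signedSwap_apply_left,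
        rootReflection_signedVec_sub_left]
  by_cases hzy : z.1 = y.1
  · rcases fst_eq_iff.1 hzy with rfl | rfl <;>
      simp only [signedVec_flip, map_neg, rep_signedVec, signedSwap_apply_right,
        rootReflection_signedVec_sub_right]
  rw [rep_signedVec, signedSwap_apply_of_fst_ne hzx hzy, eq_comm,
    rootReflection_apply_eq_self_iff, inner_sub_left, inner_signedVec_of_fst_ne (Ne.symm hzx),
    inner_signedVec_of_fst_ne (Ne.symm hzy), sub_self]

theorem movRank_rep_prod_le {L : List (W n)} (hL : ∀ t ∈ L, t ∈ reflections n) :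
    movRank (rep L.prod) ≤ L.length := by
  induction L with
  | nil => simp [movRank_one]
  | cons t L ih =>
    rw [List.forall_mem_cons] at hL
    obtain ⟨x, y, hxy, rfl⟩ := mem_reflections_iff.1 hL.1
    rw [List.prod_cons, map_mul, List.length_cons, add_comm]
    refine (movRank_mul_le _ _).trans (add_le_add ?_ (ih hL.2))
    rw [rep_signedSwap, movRank_rootReflection (signedVec_sub_ne_zero hxy)]

theorem exists_signedSwap_mul_movRank {w : W n} (hw : w ≠ 1) : ∃ x y : SignedIndex n, x ≠ y ∧
    movRank (rep (signedSwap x y * w)) + 1 = movRank (rep w) := by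
  obtain ⟨x, hx⟩ : ∃ x, w.1 x ≠ x := by
    by_contra! hall
    exact hw (Subtype.ext (Equiv.ext hall))
  refine ⟨w.1 x, x, hx, ?_⟩
  rw [map_mul, rep_signedSwap]
  apply movRank_rootReflection_mul_add_one (signedVec_sub_ne_zero hx)
  rw [← rep_signedVec]
  exact sub_mem_movSpace _ _

theorem exists_reflections_prod_eq (w : W n) :
    ∃ L : List (W n), (∀ t ∈ L, t ∈ reflections n) ∧ L.prod = w ∧
      L.length = movRank (rep w) := by
  induction hk : movRank (rep w) generalizing w with
  | zero =>
    have : w = 1 := rep_injective (by rw [eq_one_of_movRank_eq_zero hk, map_one])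
    exact ⟨[], by simp, by simp [this], rfl⟩
  | succ k ih =>
    have hw : w ≠ 1 := by
      rintro rfl
      rw [map_one, movRank_one] at hk
      exact Nat.succ_ne_zero k hk.symm
    obtain ⟨x, y, hxy, hrank⟩ := exists_signedSwap_mul_movRank hw
    obtain ⟨L, hL, hprod, hlen⟩ := ih (signedSwap x y * w) (by omega)
    have hswap : signedSwap x y ∈ reflections n := mem_reflections_iff.2 ⟨x, y, hxy, rfl⟩
    refine ⟨signedSwap x y :: L, List.forall_mem_cons.2 ⟨hswap, hL⟩, ?_, by simp [hlen]⟩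
    rw [List.prod_cons, hprod, ← mul_assoc, signedSwap_mul_self, one_mul]

theorem absLength_eq_movRank (w : W n) : absLength w = movRank (rep w) := by
  have hw := exists_reflections_prod_eq w
  refine le_antisymm (Nat.sInf_le hw) ?_
  obtain ⟨L, hL, hprod, hlen⟩ : absLength w ∈ {k | ∃ L : List (W n),
      (∀ t ∈ L, t ∈ reflections n) ∧ L.prod = w ∧ L.length = k} := Nat.sInf_mem ⟨_, hw⟩
  rw [← hlen, ← hprod]
  exact movRank_rep_prod_le hL

theorem absLE_iff {v w : W n} : AbsLE v w ↔ OrthLE (rep v) (rep w) := by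
  simp only [AbsLE, OrthLE, absLength_eq_movRank, map_mul, map_inv]

end ReflectionRepresentation

section CoxeterElement

variable {n : ℕ}

-- The sum of `g (s x)` over `I` equals the sum of `g x`, and the two sums differ only at `p`.
theorem apply_eq_of_invariant_mul {α M : Type*} [AddCancelCommMonoid M] {g : α → M}
    {s w : Equiv.Perm α} {I : Finset α} {p : α} (hp : p ∈ I)
    (hw : ∀ x ∈ I, w x ∈ I) (hs : ∀ x ∈ I, x ≠ p → s x = x) (hg : ∀ x, g (s (w x)) = g x) :
    g (s p) = g p := by
  classical
  have hmap : I.map w.toEmbedding = I :=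
    Finset.eq_of_subset_of_card_le
      (fun y hy => by obtain ⟨x, hx, rfl⟩ := Finset.mem_map.1 hy; exact hw x hx)
      (Finset.card_map _).ge
  have hsum : ∑ x ∈ I, g (s x) = ∑ x ∈ I, g x := by
    conv_lhs => rw [← hmap, Finset.sum_map]
    exact Finset.sum_congr rfl fun x _ => hg x
  rw [← Finset.add_sum_erase _ _ hp, ← Finset.add_sum_erase _ _ hp] at hsum
  refine add_right_cancel (hsum.trans (congrArg _ (Finset.sum_congr rfl fun x hx => ?_)))
  rw [Finset.mem_erase] at hx
  rw [hs x hx.2 hx.1]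

theorem invariant_signedSwap {α : Type*} {g : SignedIndex n → α} {x y : SignedIndex n}
    (h : g y = g x) (hflip : g (flip y) = g (flip x)) (z : SignedIndex n) :
    g ((signedSwap x y).1 z) = g z := by
  rw [signedSwap_apply]
  split_ifs with hx hy hx' hy'
  · rw [hx, h]
  · rw [hy, h]
  · rw [hx', hflip]
  · rw [hy', hflip]
  · rfl

theorem exists_simple_eq_signedSwap (i : Fin n) :
    ∃ y : SignedIndex n, i ≤ y.1 ∧ simple i = signedSwap (i, 1) y := by
  by_cases h : (i : ℕ) + 1 < n
  · exact ⟨_, Nat.le_succ i, simple_of_lt h⟩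
  · exact ⟨_, le_rfl, simple_of_not_lt h⟩

theorem simple_apply_of_fst_lt {i : Fin n} {x : SignedIndex n} (h : x.1 < i) :
    (simple i).1 x = x := by
  obtain ⟨y, hy, hi⟩ := exists_simple_eq_signedSwap i
  rw [hi, signedSwap_apply_of_fst_ne h.ne (h.trans_le hy).ne]

/-- The set `{1, …, i + 1}` for `e = 1`, and its negative for `e = -1`. It is mapped to itself
by all simple reflections except the one with index `i`. -/
def initialSegment (i : Fin n) (e : ℤˣ) : Finset (SignedIndex n) :=
  Finset.univ.filter fun x => x.1 ≤ i ∧ x.2 = e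

theorem mem_initialSegment {i : Fin n} {e : ℤˣ} {x : SignedIndex n} :
    x ∈ initialSegment i e ↔ x.1 ≤ i ∧ x.2 = e := by
  simp [initialSegment]

theorem simple_apply_mem_initialSegment {i k : Fin n} (hk : k ≠ i) {e : ℤˣ} {x : SignedIndex n}
    (hx : x ∈ initialSegment i e) : (simple k).1 x ∈ initialSegment i e := by
  rw [mem_initialSegment] at hx
  rcases hk.lt_or_gt with hki | hik
  · have hkn : (k : ℕ) + 1 < n := lt_of_le_of_lt (Nat.succ_le_of_lt hki) i.isLt
    rw [simple, dif_pos hkn, mem_initialSegment]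
    refine ⟨?_, hx.2⟩
    change Equiv.swap k ⟨k + 1, hkn⟩ x.1 ≤ i
    rw [Equiv.swap_apply_def]
    split_ifs
    · exact Nat.succ_le_of_lt hki
    · exact hki.le
    · exact hx.1
  · rwa [simple_apply_of_fst_lt (hx.1.trans_lt hik), mem_initialSegment]

theorem prod_simple_apply_mem_initialSegment {i : Fin n} {L : List (Fin n)} (hL : i ∉ L)
    {e : ℤˣ} {x : SignedIndex n} (hx : x ∈ initialSegment i e) :
    (L.map simple).prod.1 x ∈ initialSegment i e := by
  induction L with
  | nil => exact hx
  | cons k L ih =>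
    rw [List.mem_cons, not_or] at hL
    exact simple_apply_mem_initialSegment (Ne.symm hL.1) (ih hL.2)

theorem invariant_simple_of_invariant_prod {M : Type*} [AddCancelCommMonoid M]
    {L : List (Fin n)} (hL : L.Nodup) {g : SignedIndex n → M}
    (hg : ∀ x, g ((L.map simple).prod.1 x) = g x) {i : Fin n} (hi : i ∈ L) (x : SignedIndex n) :
    g ((simple i).1 x) = g x := by
  induction L with
  | nil => simp at hi
  | cons k L ih =>
    rw [List.nodup_cons] at hL
    have hk (e : ℤˣ) : g ((simple k).1 (k, e)) = g (k, e) := by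
      refine apply_eq_of_invariant_mul (w := (L.map simple).prod.1) (I := initialSegment k e)
        (mem_initialSegment.2 ⟨le_rfl, rfl⟩)
        (fun _ => prod_simple_apply_mem_initialSegment hL.1) (fun x hx hne => ?_) hg
      obtain ⟨hle, rfl⟩ := mem_initialSegment.1 hx
      exact simple_apply_of_fst_lt (hle.lt_of_ne fun h => hne (Prod.ext h rfl))
    have hinv (x : SignedIndex n) : g ((simple k).1 x) = g x := by
      obtain ⟨y, -, hy⟩ := exists_simple_eq_signedSwap k
      have hflip : (simple k).1 (k, -1) = flip y := by
        rw [show (k, -1) = flip (k, 1) from rfl, apply_flip, hy, signedSwap_apply_left]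
      have hpos := hk 1
      have hneg := hk (-1)
      rw [hflip] at hneg
      rw [hy, signedSwap_apply_left] at hpos
      rw [hy, invariant_signedSwap hpos hneg]
    rcases List.mem_cons.1 hi with rfl | hi
    · exact hinv x
    · exact ih hL.2 (fun x => (hinv _).symm.trans (hg x)) hi

theorem eq_of_invariant_simple {α : Type*} {g : SignedIndex n → α}
    (hg : ∀ i x, g ((simple i).1 x) = g x) (x y : SignedIndex n) : g x = g y := by
  have hn := x.1.pos
  have hzero (k : ℕ) (hk : k < n) (e : ℤˣ) : g (⟨k, hk⟩, e) = g (⟨0, hn⟩, e) := by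
    induction k with
    | zero => rfl
    | succ k ih =>
      rw [← ih (by omega), ← hg ⟨k, by omega⟩ (⟨k, by omega⟩, e), simple, dif_pos hk]
      exact congrArg g (Prod.ext (Equiv.swap_apply_left _ _).symm rfl)
  have hsign (e : ℤˣ) : g (⟨0, hn⟩, e) = g (⟨0, hn⟩, 1) := by
    rcases Int.units_eq_one_or e with rfl | rfl
    · rfl
    · have hlast : n - 1 < n := by omega
      have h := hg ⟨n - 1, hlast⟩ (⟨n - 1, hlast⟩, 1)
      rwa [simple_of_not_lt (by simp only; omega), signedSwap_apply_left, hzero _ _ 1,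
        hzero] at h
  have hconst (z : SignedIndex n) : g z = g (⟨0, hn⟩, 1) := by rw [← hsign z.2, ← hzero z.1]
  rw [hconst x, hconst y]

theorem sameCycle_prod_simple {L : List (Fin n)} (hL : L.Nodup) (hmem : ∀ i, i ∈ L)
    (x y : SignedIndex n) : (L.map simple).prod.1.SameCycle x y := by
  classical
  let g (z : SignedIndex n) : ℤ := if (L.map simple).prod.1.SameCycle x z then 1 else 0
  have hg (z : SignedIndex n) : g ((L.map simple).prod.1 z) = g z := by
    simp only [g, Equiv.Perm.sameCycle_apply_right]
  have h := eq_of_invariant_simple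
    (fun i => invariant_simple_of_invariant_prod hL hg (hmem i)) x y
  by_contra hne
  simp only [g, if_neg hne, if_pos (Equiv.Perm.SameCycle.refl _ x)] at h
  exact one_ne_zero h

theorem IsCoxeterElement.sameCycle {c : W n} (hc : IsCoxeterElement c) (x y : SignedIndex n) :
    c.1.SameCycle x y := by
  obtain ⟨σ, w, rfl⟩ := hc
  rw [show (List.ofFn fun i => simple (σ i)) = (List.ofFn σ).map simple by
    rw [List.map_ofFn]; rfl]
  have h := (sameCycle_prod_simple (List.nodup_ofFn.2 σ.injective)
    (fun i => List.mem_ofFn.2 (σ.surjective i)) (w.1⁻¹ x) (w.1⁻¹ y)).conj (g := w.1)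
  simpa using h

theorem exists_zmod_equiv_of_sameCycle {α : Type*} [Fintype α] [Nonempty α] {N : ℕ}
    (hN : Fintype.card α = N) {σ : Equiv.Perm α} (hσ : ∀ x y, σ.SameCycle x y) :
    ∃ f : ZMod N ≃ α, ∀ k, f (k + 1) = σ (f k) := by
  classical
  have : NeZero N := ⟨hN ▸ Fintype.card_ne_zero⟩
  obtain ⟨x₀⟩ := ‹Nonempty α›
  have hcycle : σ.IsCycleOn (Finset.univ : Finset α) :=
    ⟨by simp [Set.bijOn_univ], fun x _ y _ => hσ x y⟩
  have hpow (a b : ℕ) : (σ ^ a) x₀ = (σ ^ b) x₀ ↔ (a : ZMod N) = b := by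
    rw [hcycle.pow_apply_eq_pow_apply (Finset.mem_univ _), Finset.card_univ, hN,
      ZMod.natCast_eq_natCast_iff]
  let f (k : ZMod N) : α := (σ ^ k.val) x₀
  have hf : Function.Bijective f := by
    refine (Fintype.bijective_iff_injective_and_card f).2 ⟨fun a b hab => ?_, by
      rw [ZMod.card, hN]⟩
    rwa [hpow, ZMod.natCast_zmod_val, ZMod.natCast_zmod_val] at hab
  refine ⟨Equiv.ofBijective f hf, fun k => ?_⟩
  change (σ ^ (k + 1).val) x₀ = σ ((σ ^ k.val) x₀)
  rw [← Equiv.Perm.mul_apply, ← pow_succ', hpow]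
  simp

theorem IsCoxeterElement.exists_isPolygonLabelling [NeZero n] {c : W n}
    (hc : IsCoxeterElement c) : ∃ f : ZMod (2 * n) ≃ SignedIndex n, IsPolygonLabelling c f :=
  exists_zmod_equiv_of_sameCycle (by simp [mul_comm]) hc.sameCycle

end CoxeterElement

section Labelling

variable {n : ℕ} [NeZero n] {c : W n} {f : ZMod (2 * n) ≃ SignedIndex n}

theorem zmod_induction {m : ℕ} [NeZero m] {P : ZMod m → Prop} (zero : P 0)
    (add_one : ∀ k, P k → P (k + 1)) (k : ZMod m) : P k := by
  obtain ⟨j, rfl⟩ := ZMod.natCast_zmod_surjective k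
  induction j with
  | zero => simpa only [Nat.cast_zero] using zero
  | succ j ih => exact Nat.cast_succ (R := ZMod m) j ▸ add_one _ ih

namespace IsPolygonLabelling

theorem apply_of_commute (hf : IsPolygonLabelling c f)
    {u : SignedIndex n → SignedIndex n} (hu : ∀ x, u (c.1 x) = c.1 (u x)) (k : ZMod (2 * n)) :
    u (f k) = f (k + f.symm (u (f 0))) := by
  induction k using zmod_induction with
  | zero => rw [zero_add, f.apply_symm_apply]
  | add_one k ih => rw [hf, hu, ih, ← hf, add_right_comm]

theorem apply_of_reverse (hf : IsPolygonLabelling c f)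
    {u : SignedIndex n → SignedIndex n} (hu : ∀ x, c.1 (u (c.1 x)) = u x) (k : ZMod (2 * n)) :
    u (f k) = f (f.symm (u (f 0)) - k) := by
  induction k using zmod_induction with
  | zero => rw [sub_zero, f.apply_symm_apply]
  | add_one k ih =>
    apply c.1.injective
    rw [hf, hu, ih, ← hf, ← sub_sub, sub_add_cancel]

theorem add_natCast (hf : IsPolygonLabelling c f) (k : ZMod (2 * n)) :
    f (k + n) = flip (f k) := by
  set a := f.symm (flip (f 0))
  have hflip (k : ZMod (2 * n)) : flip (f k) = f (k + a) :=
    hf.apply_of_commute (fun x => (apply_flip c x).symm) k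
  have ha : a ≠ 0 := by
    intro ha
    have h := hflip 0
    rw [ha, add_zero] at h
    exact flip_ne _ h
  have hneg : -a = a := by
    have h := congrArg flip (hflip 0)
    rw [flip_flip, hflip, f.apply_eq_iff_eq, zero_add] at h
    exact neg_eq_of_add_eq_zero_left h.symm
  have hval : a.val = n := by
    have := ((ZMod.neg_eq_self_iff a).1 hneg).resolve_left ha
    omega
  have hn : (n : ZMod (2 * n)) = a :=
    (congrArg Nat.cast hval).symm.trans (ZMod.natCast_zmod_val a)
  rw [hflip, hn]

end IsPolygonLabelling

end Labelling

section NonCrossingPartitions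

variable {n : ℕ}

theorem signedVec_apply_sub_mem_movSpace (w : W n) (x : SignedIndex n) :
    signedVec (w.1 x) - signedVec x ∈ movSpace (rep w) := by
  rw [← rep_signedVec]
  exact sub_mem_movSpace _ _

theorem movSpace_rep_le_iff {w : W n} {S : Submodule ℝ (EuclideanSpace ℝ (Fin n))} :
    movSpace (rep w) ≤ S ↔ ∀ x, signedVec (w.1 x) - signedVec x ∈ S := by
  refine ⟨fun h x => h (signedVec_apply_sub_mem_movSpace w x), fun h => ?_⟩
  have hcomap : S.comap (subOne (rep w)) = ⊤ := by
    rw [eq_top_iff, ← (signedBasis 1).toBasis.span_eq, Submodule.span_le]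
    rintro _ ⟨i, rfl⟩
    simpa [signedBasis, subOne, rep_signedVec] using h (i, 1)
  rintro _ ⟨v, rfl⟩
  exact Submodule.eq_top_iff'.1 hcomap v

theorem exists_eq_signedSwap_of_movRank_eq_one {w : W n} (hw : movRank (rep w) = 1) :
    ∃ x y : SignedIndex n, x ≠ y ∧ w = signedSwap x y := by
  have hne : w ≠ 1 := by
    rintro rfl
    rw [map_one, movRank_one] at hw
    exact zero_ne_one hw
  obtain ⟨x, y, hxy, hrank⟩ := exists_signedSwap_mul_movRank hne
  refine ⟨x, y, hxy, ?_⟩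
  have hone : signedSwap x y * w = 1 := rep_injective <|
    (eq_one_of_movRank_eq_zero (by omega)).trans (map_one rep).symm
  exact (inv_eq_of_mul_eq_one_right hone).symm.trans (signedSwap_inv x y)

variable {c : W n}

namespace NC

/-- The rank of a non-crossing partition. -/
noncomputable def rank (w : NC c) : ℕ := movRank (rep w.1)

/-- The moved space of a non-crossing partition, which determines it. -/
noncomputable def mov (w : NC c) : Submodule ℝ (EuclideanSpace ℝ (Fin n)) := movSpace (rep w.1)

theorem orthLE (w : NC c) : OrthLE (rep w.1) (rep c) := absLE_iff.1 w.2

theorem le_iff_mov_le {v w : NC c} : v ≤ w ↔ v.mov ≤ w.mov :=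
  absLE_iff.trans ⟨OrthLE.movSpace_le, v.orthLE.of_movSpace_le w.orthLE⟩

theorem mov_injective : Function.Injective (mov (c := c)) := fun v w h =>
  Subtype.ext (rep_injective (v.orthLE.eq_of_movSpace_eq w.orthLE h))

theorem eq_of_le_of_rank_le {v w : NC c} (h : v ≤ w) (h' : w.rank ≤ v.rank) : v = w :=
  mov_injective (Submodule.eq_of_le_of_finrank_le (le_iff_mov_le.1 h) h')

theorem exists_le_rank_add_one {w : NC c} (h : w.rank ≠ 0) :
    ∃ v : NC c, v ≤ w ∧ v.rank + 1 = w.rank := by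
  have hne : w.1 ≠ 1 := by
    intro hw
    rw [rank, hw, map_one, movRank_one] at h
    exact h rfl
  obtain ⟨x, y, hxy, hrank⟩ := exists_signedSwap_mul_movRank hne
  have hconj : (signedSwap x y * w.1)⁻¹ * w.1 =
      signedSwap ((w.1⁻¹).1 x) ((w.1⁻¹).1 y) := by
    rw [← conj_signedSwap, inv_inv, mul_inv_rev, signedSwap_inv]
  have hle : OrthLE (rep (signedSwap x y * w.1)) (rep w.1) := by
    rw [OrthLE, ← map_inv, ← map_mul, hconj, rep_signedSwap, movRank_rootReflection, hrank]
    exact signedVec_sub_ne_zero ((w.1⁻¹).1.injective.ne hxy)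
  exact ⟨⟨signedSwap x y * w.1, absLE_iff.2 (hle.trans w.orthLE)⟩, absLE_iff.2 hle, hrank⟩

theorem rank_le_rank_apply (φ : NC c ≃o NC c) (w : NC c) : w.rank ≤ (φ w).rank := by
  induction hk : w.rank generalizing w with
  | zero => exact Nat.zero_le _
  | succ k ih =>
    obtain ⟨v, hvw, hv⟩ := exists_le_rank_add_one (w := w) (by omega)
    by_contra hlt
    have hrank := ih v (by omega)
    have heq := φ.injective (eq_of_le_of_rank_le (φ.map_rel_iff.2 hvw) (by omega))
    rw [heq] at hv
    omega

theorem rank_apply (φ : NC c ≃o NC c) (w : NC c) : (φ w).rank = w.rank :=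
  ((rank_le_rank_apply φ.symm (φ w)).trans_eq (by rw [φ.symm_apply_apply])).antisymm
    (rank_le_rank_apply φ w)

/-- A set of non-crossing partitions is coplanar if it has an upper bound of rank two. This is the
invariant of lattice automorphisms that detects the edges of the polygon and their adjacency. -/
def Coplanar (s : Set (NC c)) : Prop := ∃ w : NC c, w.rank = 2 ∧ ∀ a ∈ s, a ≤ w

theorem Coplanar.image {s : Set (NC c)} (h : Coplanar s) (φ : NC c ≃o NC c) :
    Coplanar (φ '' s) := by
  obtain ⟨w, hw, hs⟩ := h
  refine ⟨φ w, by rw [rank_apply, hw], ?_⟩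
  rintro _ ⟨a, ha, rfl⟩
  exact φ.map_rel_iff.2 (hs a ha)

theorem Coplanar.apply_pair {a b : NC c} (h : Coplanar {a, b}) (φ : NC c ≃o NC c) :
    Coplanar {φ a, φ b} := by
  simpa only [Set.image_pair] using h.image φ

theorem Coplanar.apply_triple {a b d : NC c} (h : Coplanar {a, b, d}) (φ : NC c ≃o NC c) :
    Coplanar {φ a, φ b, φ d} := by
  simpa only [Set.image_insert_eq, Set.image_singleton] using h.image φ

theorem mov_sup_mov_eq {a b w : NC c} (ha : a.rank = 1) (hb : b.rank = 1) (hab : a ≠ b)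
    (hw : w.rank = 2) (haw : a ≤ w) (hbw : b ≤ w) : a.mov ⊔ b.mov = w.mov := by
  apply Submodule.eq_of_le_of_finrank_le (sup_le (le_iff_mov_le.1 haw) (le_iff_mov_le.1 hbw))
  have hlt : a.mov < a.mov ⊔ b.mov := by
    refine left_lt_sup.2 fun hba => hab ?_
    exact (eq_of_le_of_rank_le (le_iff_mov_le.2 hba) (by rw [ha, hb])).symm
  have hfin := Submodule.finrank_lt_finrank_of_lt hlt
  change w.rank ≤ _
  change a.rank < _ at hfin
  omega

theorem coplanar_triple_iff {a b d : NC c} (ha : a.rank = 1) (hb : b.rank = 1) (hab : a ≠ b) :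
    Coplanar {a, b, d} ↔ Coplanar {a, b} ∧ d.mov ≤ a.mov ⊔ b.mov := by
  simp only [Coplanar, Set.forall_mem_insert, Set.mem_singleton_iff, forall_eq]
  constructor
  · rintro ⟨w, hw, haw, hbw, hdw⟩
    exact ⟨⟨w, hw, haw, hbw⟩, mov_sup_mov_eq ha hb hab hw haw hbw ▸ le_iff_mov_le.1 hdw⟩
  · rintro ⟨⟨w, hw, haw, hbw⟩, hd⟩
    rw [mov_sup_mov_eq ha hb hab hw haw hbw] at hd
    exact ⟨w, hw, haw, hbw, le_iff_mov_le.2 hd⟩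

end NC

end NonCrossingPartitions

section Chords

variable {n : ℕ} {c : W n} (hc : movSpace (rep c) = ⊤)

/-- The reflection that exchanges the labels `x` and `y`, as a non-crossing partition. In the
pictures on the `2n`-gon it is the chord from `x` to `y` together with its image under the central
symmetry; for `y = -x` it is a diameter. The case `x = y` gives the least element. -/
def chord (x y : SignedIndex n) : NC c := ⟨signedSwap x y, absLE_iff.2 <| by
  rw [rep_signedSwap, rootReflection_orthLE_iff, hc]
  trivial⟩

theorem chord_mov (x y : SignedIndex n) :
    (chord hc x y).mov = Submodule.span ℝ {signedVec x - signedVec y} := by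
  rw [NC.mov, chord, rep_signedSwap, movSpace_rootReflection]

theorem chord_rank {x y : SignedIndex n} (h : x ≠ y) : (chord hc x y).rank = 1 := by
  rw [NC.rank, chord, rep_signedSwap, movRank_rootReflection (signedVec_sub_ne_zero h)]

theorem chord_le_iff {x y : SignedIndex n} {w : NC c} :
    chord hc x y ≤ w ↔ signedVec x - signedVec y ∈ w.mov := by
  rw [NC.le_iff_mov_le, chord_mov, Submodule.span_singleton_le_iff_mem]

theorem exists_eq_chord {a : NC c} (ha : a.rank = 1) : ∃ x y, x ≠ y ∧ a = chord hc x y := by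
  obtain ⟨x, y, hxy, h⟩ := exists_eq_signedSwap_of_movRank_eq_one ha
  exact ⟨x, y, hxy, Subtype.ext h⟩

theorem chord_eq_of_smul {x y p q : SignedIndex n} (hpq : p ≠ q) {r : ℝ}
    (h : r • (signedVec x - signedVec y) = signedVec p - signedVec q) :
    chord hc x y = chord hc p q := by
  have hr : r ≠ 0 := by
    rintro rfl
    exact signedVec_sub_ne_zero hpq (by rw [← h, zero_smul])
  apply NC.mov_injective
  rw [chord_mov, chord_mov, ← h, Submodule.span_singleton_smul_eq (IsUnit.mk0 r hr)]

theorem chord_comm (x y : SignedIndex n) : chord hc x y = chord hc y x :=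
  Subtype.ext (eq_signedSwap (signedSwap_apply_right x y) (signedSwap_apply_left x y)
    fun _ hy hx => signedSwap_apply_of_fst_ne hx hy)

theorem chord_flip (x y : SignedIndex n) : chord hc (flip x) (flip y) = chord hc x y := by
  apply NC.mov_injective
  rw [chord_mov, chord_mov, signedVec_flip, signedVec_flip, neg_sub_neg, ← neg_sub,
    ← Set.neg_singleton, Submodule.span_neg]

theorem fst_eq_or_fst_eq_of_chord_eq {x y p q : SignedIndex n} (hxy : x ≠ y)
    (h : chord hc x y = chord hc p q) : x.1 = p.1 ∨ x.1 = q.1 := by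
  by_contra! hne
  have hx := signedSwap_apply_of_fst_ne hne.1 hne.2
  rw [← show signedSwap x y = signedSwap p q from congrArg Subtype.val h,
    signedSwap_apply_left] at hx
  exact hxy hx.symm

include hc in
theorem NC.le_of_forall_rank_one {v w : NC c} (h : ∀ a : NC c, a.rank = 1 → a ≤ v → a ≤ w) :
    v ≤ w := by
  rw [NC.le_iff_mov_le]
  refine movSpace_rep_le_iff.2 fun x => ?_
  by_cases hx : v.1.1 x = x
  · rw [hx, sub_self]
    exact w.mov.zero_mem
  · rw [← chord_le_iff hc]
    exact h _ (chord_rank hc hx)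
      ((chord_le_iff hc).2 (signedVec_apply_sub_mem_movSpace v.1 x))

include hc in
theorem NC.eq_one_of_forall_rank_one {φ : NC c ≃o NC c} (h : ∀ a, a.rank = 1 → φ a = a) :
    φ = 1 := by
  have hle (w a : NC c) (ha : a.rank = 1) : a ≤ φ w ↔ a ≤ w := by
    conv_lhs => rw [← h a ha]
    exact φ.map_rel_iff
  refine RelIso.ext fun w => NC.mov_injective (le_antisymm ?_ ?_)
  · exact NC.le_iff_mov_le.1 (NC.le_of_forall_rank_one hc fun a ha => (hle w a ha).1)
  · exact NC.le_iff_mov_le.1 (NC.le_of_forall_rank_one hc fun a ha => (hle w a ha).2)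

theorem coplanar_chord_iff {x y p q r s : SignedIndex n} (hxy : x ≠ y) (hpq : p ≠ q)
    (hne : chord hc x y ≠ chord hc p q) :
    NC.Coplanar {chord hc x y, chord hc p q, chord hc r s} ↔
      NC.Coplanar {chord hc x y, chord hc p q} ∧ ∃ a b : ℝ,
        a • (signedVec x - signedVec y) + b • (signedVec p - signedVec q) =
          signedVec r - signedVec s := by
  rw [NC.coplanar_triple_iff (chord_rank hc hxy) (chord_rank hc hpq) hne, chord_mov, chord_mov,
    chord_mov, ← Submodule.span_insert, Submodule.span_singleton_le_iff_mem,
    Submodule.mem_span_pair]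

theorem coplanar_chord_of_inner_eq_zero {x y p q : SignedIndex n} (hxy : x ≠ y) (hpq : p ≠ q)
    {u : EuclideanSpace ℝ (Fin n)} (hu : rep c u - u = signedVec x - signedVec y)
    (h : inner ℝ u (signedVec p - signedVec q) = 0) :
    NC.Coplanar {chord hc x y, chord hc p q} := by
  have ha := signedVec_sub_ne_zero hxy
  have hb := signedVec_sub_ne_zero hpq
  obtain ⟨hle, hrank⟩ := rootReflection_mul_orthLE ha hb hu (hc ▸ Submodule.mem_top) h
  have hsup := OrthLE.movSpace_eq_sup (A := rootReflection (signedVec x - signedVec y))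
    (B := rootReflection (signedVec x - signedVec y) * rootReflection (signedVec p - signedVec q))
    (by rw [OrthLE, inv_mul_cancel_left, hrank, movRank_rootReflection ha,
      movRank_rootReflection hb])
  rw [inv_mul_cancel_left, movSpace_rootReflection, movSpace_rootReflection] at hsup
  rw [← rep_signedSwap, ← rep_signedSwap, ← map_mul] at hle hrank hsup
  refine ⟨⟨signedSwap x y * signedSwap p q, absLE_iff.2 hle⟩, hrank, ?_⟩
  simp only [Set.forall_mem_insert, Set.mem_singleton_iff, forall_eq]
  constructor
  · exact (chord_le_iff hc).2 <| hsup.ge <| Submodule.mem_sup_left <|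
      Submodule.mem_span_singleton_self _
  · exact (chord_le_iff hc).2 <| hsup.ge <| Submodule.mem_sup_right <|
      Submodule.mem_span_singleton_self _

-- The root `signedVec p - signedVec q` belongs to the second factor of a factorization
-- `w = signedSwap x y * signedSwap p q`.
theorem exists_inner_eq_zero_of_chord_le {w : NC c} (hw : w.rank = 2) {x y : SignedIndex n}
    (hxy : x ≠ y) (hle : chord hc x y ≤ w) {u : EuclideanSpace ℝ (Fin n)}
    (hu : rep c u - u = signedVec x - signedVec y) : ∃ p q, p ≠ q ∧
      signedVec p - signedVec q ∈ w.mov ∧ inner ℝ (signedVec p - signedVec q) u = 0 := by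
  have ha := signedVec_sub_ne_zero hxy
  rw [chord_le_iff] at hle
  have hrank := movRank_rootReflection_mul_add_one ha hle
  rw [← rep_signedSwap, ← map_mul] at hrank
  obtain ⟨p, q, hpq, hfactor⟩ := exists_eq_signedSwap_of_movRank_eq_one
    (w := signedSwap x y * w.1) (by change _ = w.rank at hrank; omega)
  have hrep : rootReflection (signedVec x - signedVec y) * rep w.1 =
      rootReflection (signedVec p - signedVec q) := by
    rw [← rep_signedSwap, ← rep_signedSwap, ← map_mul, hfactor]
  refine ⟨p, q, hpq, ?_, ?_⟩
  · have hmov := movSpace_mul_le (rootReflection (signedVec x - signedVec y)) (rep w.1)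
    rw [hrep, movSpace_rootReflection, movSpace_rootReflection] at hmov
    exact hmov.trans (sup_le ((Submodule.span_singleton_le_iff_mem _ _).2 hle) le_rfl)
      (Submodule.mem_span_singleton_self _)
  · have hcx : rep c u = rootReflection (signedVec x - signedVec y) u := by
      rw [← rep_signedSwap]
      refine (chord hc x y).orthLE.apply_eq_of_sub_mem ?_
      rw [hu, ← NC.mov, chord_mov]
      exact Submodule.mem_span_singleton_self _
    have hcw : rep c u = rep w.1 u := w.orthLE.apply_eq_of_sub_mem (hu ▸ hle)
    rw [← rootReflection_apply_eq_self_iff, ← hrep, isometry_mul_apply, ← hcw, hcx,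
      ← isometry_mul_apply, rootReflection_mul_self]
    rfl

theorem inner_signedVec_sub_of_fst_ne {x p q : SignedIndex n} (hp : x.1 ≠ p.1) (hq : x.1 ≠ q.1) :
    inner ℝ (signedVec x) (signedVec p - signedVec q) = 0 := by
  rw [inner_sub_right, inner_signedVec_of_fst_ne hp, inner_signedVec_of_fst_ne hq, sub_self]

-- A root has at most two nonzero coordinates.
theorem inner_signedVec_sub_eq_zero_or {x y z : SignedIndex n} (hxy : x.1 ≠ y.1)
    (hxz : x.1 ≠ z.1) (hyz : y.1 ≠ z.1) (p q : SignedIndex n) :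
    inner ℝ (signedVec x) (signedVec p - signedVec q) = 0 ∨
      inner ℝ (signedVec y) (signedVec p - signedVec q) = 0 ∨
      inner ℝ (signedVec z) (signedVec p - signedVec q) = 0 := by
  have h : (x.1 ≠ p.1 ∧ x.1 ≠ q.1) ∨ (y.1 ≠ p.1 ∧ y.1 ≠ q.1) ∨ (z.1 ≠ p.1 ∧ z.1 ≠ q.1) := by
    grind
  exact h.imp (fun h => inner_signedVec_sub_of_fst_ne h.1 h.2)
    (Or.imp (fun h => inner_signedVec_sub_of_fst_ne h.1 h.2)
      fun h => inner_signedVec_sub_of_fst_ne h.1 h.2)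

theorem eq_chord_of_coplanar_chain {x y z : SignedIndex n} (hxy : x.1 ≠ y.1) (hxz : x.1 ≠ z.1)
    (hyz : y.1 ≠ z.1) {d : NC c} (hd : d.rank = 1)
    (h : NC.Coplanar {chord hc x y, chord hc y z, d}) :
    d = chord hc x y ∨ d = chord hc y z ∨ d = chord hc x z := by
  obtain ⟨p, q, hpq, rfl⟩ := exists_eq_chord hc hd
  have hne : chord hc x y ≠ chord hc y z := fun he =>
    (fst_eq_or_fst_eq_of_chord_eq hc (ne_of_apply_ne Prod.fst hxy) he).elim hxy hxz
  obtain ⟨-, a, b, hab⟩ := (coplanar_chord_iff hc (ne_of_apply_ne Prod.fst hxy)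
    (ne_of_apply_ne Prod.fst hyz) hne).1 h
  have hzero := inner_signedVec_sub_eq_zero_or hxy hxz hyz p q
  simp only [← hab, inner_add_right, inner_sub_right, inner_smul_right, inner_signedVec_self,
    inner_signedVec_of_fst_ne hxy, inner_signedVec_of_fst_ne hxz, inner_signedVec_of_fst_ne hyz,
    inner_signedVec_of_fst_ne hxy.symm, inner_signedVec_of_fst_ne hxz.symm,
    inner_signedVec_of_fst_ne hyz.symm] at hzero
  rcases hzero with h0 | h0 | h0
  · refine Or.inr (Or.inl (chord_eq_of_smul hc hpq (r := b) ?_).symm)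
    rw [← hab, show a = 0 by linarith, zero_smul, zero_add]
  · refine Or.inr (Or.inr (chord_eq_of_smul hc hpq (r := a) ?_).symm)
    rw [← hab, show b = a by linarith]
    module
  · refine Or.inl (chord_eq_of_smul hc hpq (r := a) ?_).symm
    rw [← hab, show b = 0 by linarith, zero_smul, add_zero]

theorem eq_chord_of_coplanar_of_disjoint {x y z t : SignedIndex n} (hxy : x.1 ≠ y.1)
    (hxz : x.1 ≠ z.1) (hyz : y.1 ≠ z.1) (hxt : x.1 ≠ t.1) (hyt : y.1 ≠ t.1) (hzt : z.1 ≠ t.1)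
    {d : NC c} (hd : d.rank = 1) (h : NC.Coplanar {chord hc x y, chord hc z t, d}) :
    d = chord hc x y ∨ d = chord hc z t := by
  obtain ⟨p, q, hpq, rfl⟩ := exists_eq_chord hc hd
  have hne : chord hc x y ≠ chord hc z t := fun he =>
    (fst_eq_or_fst_eq_of_chord_eq hc (ne_of_apply_ne Prod.fst hxy) he).elim hxz hxt
  obtain ⟨-, a, b, hab⟩ := (coplanar_chord_iff hc (ne_of_apply_ne Prod.fst hxy)
    (ne_of_apply_ne Prod.fst hzt) hne).1 h
  have hzero := inner_signedVec_sub_eq_zero_or hxy hxz hyz p q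
  simp only [← hab, inner_add_right, inner_sub_right, inner_smul_right, inner_signedVec_self,
    inner_signedVec_of_fst_ne hxy, inner_signedVec_of_fst_ne hxz, inner_signedVec_of_fst_ne hyz,
    inner_signedVec_of_fst_ne hxy.symm, inner_signedVec_of_fst_ne hxz.symm,
    inner_signedVec_of_fst_ne hyz.symm, inner_signedVec_of_fst_ne hxt,
    inner_signedVec_of_fst_ne hyt, inner_signedVec_of_fst_ne hzt] at hzero
  by_cases ha : a = 0
  · refine Or.inr (chord_eq_of_smul hc hpq (r := b) ?_).symm
    rw [← hab, ha, zero_smul, zero_add]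
  · have hb : b = 0 := by grind
    refine Or.inl (chord_eq_of_smul hc hpq (r := a) ?_).symm
    rw [← hab, hb, zero_smul, add_zero]

end Chords

section Edges

variable {n : ℕ} {c : W n} (hc : movSpace (rep c) = ⊤)

theorem coplanar_edge_of_inner_eq_zero {x p q : SignedIndex n} (hx : x.1 ≠ (c.1 x).1) (hpq : p ≠ q)
    (h : inner ℝ (signedVec x) (signedVec p - signedVec q) = 0) :
    NC.Coplanar {chord hc x (c.1 x), chord hc p q} := by
  refine coplanar_chord_of_inner_eq_zero hc (ne_of_apply_ne Prod.fst hx) hpq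
    (u := -signedVec x) ?_ ?_
  · rw [map_neg, rep_signedVec, neg_sub_neg]
  · rw [inner_neg_left, h, neg_zero]

theorem coplanar_edge_of_inner_apply_eq_zero {x p q : SignedIndex n} (hx : x.1 ≠ (c.1 x).1)
    (hpq : p ≠ q) (h : inner ℝ (signedVec (c.1 x)) (signedVec p - signedVec q) = 0) :
    NC.Coplanar {chord hc x (c.1 x), chord hc p q} := by
  obtain ⟨u, hu⟩ := mem_movSpace.1
    (show signedVec p - signedVec q ∈ movSpace (rep c) from hc ▸ Submodule.mem_top)
  rw [Set.pair_comm]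
  refine coplanar_chord_of_inner_eq_zero hc hpq (ne_of_apply_ne Prod.fst hx) hu ?_
  rw [← neg_sub, inner_neg_right, ← rep_signedVec, inner_apply_sub, hu, rep_signedVec, neg_neg,
    real_inner_comm, h]

theorem coplanar_edge_of_fst_eq {x p q : SignedIndex n} (hx : x.1 ≠ (c.1 x).1)
    (hp : p.1 = x.1) (hq : q.1 = (c.1 x).1) :
    NC.Coplanar {chord hc x (c.1 x), chord hc p q} := by
  have hflip := (flip_ne (c.1 x)).symm
  have hdiam : NC.Coplanar {chord hc x (c.1 x), chord hc (c.1 x) (flip (c.1 x))} :=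
    coplanar_edge_of_inner_eq_zero hc hx hflip (inner_signedVec_sub_of_fst_ne hx hx)
  have hne : chord hc x (c.1 x) ≠ chord hc (c.1 x) (flip (c.1 x)) := fun h =>
    (fst_eq_or_fst_eq_of_chord_eq hc (ne_of_apply_ne Prod.fst hx) h).elim hx hx
  have hspan : ∃ a b : ℝ, a • (signedVec x - signedVec (c.1 x)) +
      b • (signedVec (c.1 x) - signedVec (flip (c.1 x))) = signedVec p - signedVec q := by
    rcases fst_eq_iff.1 hp with rfl | rfl <;> rcases fst_eq_iff.1 hq with rfl | rfl <;>
      simp only [signedVec_flip]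
    exacts [⟨1, 0, by module⟩, ⟨1, 1, by module⟩, ⟨-1, -1, by module⟩, ⟨-1, 0, by module⟩]
  obtain ⟨w, hw, hle⟩ :=
    (coplanar_chord_iff hc (ne_of_apply_ne Prod.fst hx) hflip hne).2 ⟨hdiam, hspan⟩
  exact ⟨w, hw, fun a ha => hle a (by grind)⟩

theorem coplanar_edge {x p q : SignedIndex n} (hx : x.1 ≠ (c.1 x).1) (hpq : p ≠ q) :
    NC.Coplanar {chord hc x (c.1 x), chord hc p q} := by
  by_cases hxp : x.1 ≠ p.1 ∧ x.1 ≠ q.1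
  · exact coplanar_edge_of_inner_eq_zero hc hx hpq (inner_signedVec_sub_of_fst_ne hxp.1 hxp.2)
  by_cases hcx : (c.1 x).1 ≠ p.1 ∧ (c.1 x).1 ≠ q.1
  · exact coplanar_edge_of_inner_apply_eq_zero hc hx hpq
      (inner_signedVec_sub_of_fst_ne hcx.1 hcx.2)
  rcases eq_or_ne p.1 x.1 with hp | hp
  · exact coplanar_edge_of_fst_eq hc hx hp (by grind)
  · rw [chord_comm hc p q]
    exact coplanar_edge_of_fst_eq hc hx (by grind) (by grind)

theorem not_coplanar_chord_diameter {x y z : SignedIndex n} (hxy : x.1 ≠ y.1) (hxz : x.1 ≠ z.1)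
    (hyz : y.1 ≠ z.1) {u : EuclideanSpace ℝ (Fin n)}
    (hu : rep c u - u = signedVec x - signedVec z) (hxu : inner ℝ (signedVec x) u = -1)
    (hyu : inner ℝ (signedVec y) u = -1) (hzu : inner ℝ (signedVec z) u = 0) :
    ¬NC.Coplanar {chord hc x z, chord hc y (flip y)} := by
  rintro ⟨w, hw, hle⟩
  simp only [Set.forall_mem_insert, Set.mem_singleton_iff, forall_eq] at hle
  have hxz' := ne_of_apply_ne Prod.fst hxz
  obtain ⟨p, q, hpq, hmov, hinner⟩ := exists_inner_eq_zero_of_chord_le hc hw hxz' hle.1 hu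
  have hne : chord hc x z ≠ chord hc y (flip y) := fun h =>
    (fst_eq_or_fst_eq_of_chord_eq hc hxz' h).elim hxy hxy
  have hcop : NC.Coplanar {chord hc x z, chord hc y (flip y), chord hc p q} :=
    ⟨w, hw, by simpa only [Set.forall_mem_insert, Set.mem_singleton_iff, forall_eq] using
      ⟨hle.1, hle.2, (chord_le_iff hc).2 hmov⟩⟩
  obtain ⟨-, a, b, hab⟩ := (coplanar_chord_iff hc hxz' (flip_ne y).symm hne).1 hcop
  have hzero := inner_signedVec_sub_eq_zero_or hxy hxz hyz p q
  simp only [← hab, signedVec_flip, inner_add_right, inner_sub_right, inner_smul_right,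
    inner_neg_right, inner_add_left, inner_sub_left, inner_smul_left, inner_neg_left,
    inner_signedVec_self, inner_signedVec_of_fst_ne hxy, inner_signedVec_of_fst_ne hxz,
    inner_signedVec_of_fst_ne hyz, inner_signedVec_of_fst_ne hxy.symm,
    inner_signedVec_of_fst_ne hxz.symm, inner_signedVec_of_fst_ne hyz.symm, hxu, hyu, hzu,
    RCLike.conj_to_real] at hzero hinner
  have ha : a = 0 := by grind
  have hb : b = 0 := by grind
  rw [ha, hb, zero_smul, zero_smul, add_zero] at hab
  exact signedVec_sub_ne_zero hpq hab.symm

theorem coplanar_chord_trans {x y z : SignedIndex n} (hxy : x.1 ≠ y.1) (hyz : y.1 ≠ z.1)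
    (hxz : x.1 ≠ z.1) (h : NC.Coplanar {chord hc x y, chord hc y z}) :
    NC.Coplanar {chord hc x y, chord hc y z, chord hc x z} := by
  have hne : chord hc x y ≠ chord hc y z := fun he =>
    (fst_eq_or_fst_eq_of_chord_eq hc (ne_of_apply_ne Prod.fst hxy) he).elim hxy hxz
  exact (coplanar_chord_iff hc (ne_of_apply_ne Prod.fst hxy) (ne_of_apply_ne Prod.fst hyz) hne).2
    ⟨h, 1, 1, by module⟩

end Edges

section Diagonals

variable {n : ℕ} [NeZero n] {c : W n} {f : ZMod (2 * n) ≃ SignedIndex n}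

namespace IsPolygonLabelling

theorem movSpace_rep (hf : IsPolygonLabelling c f) : movSpace (rep c) = ⊤ := by
  rw [movSpace_eq_orthogonal, Submodule.orthogonal_eq_top_iff, Submodule.eq_bot_iff]
  intro v hv
  have hconst (k : ZMod (2 * n)) : inner ℝ (signedVec (f k)) v = inner ℝ (signedVec (f 0)) v := by
    induction k using zmod_induction with
    | zero => rfl
    | add_one k ih =>
      rw [hf, ← rep_signedVec, ← ih]
      nth_rw 1 [← mem_fixSpace.1 hv]
      exact (rep c).inner_map_map _ _
  have hzero (x : SignedIndex n) : inner ℝ (signedVec x) v = 0 := by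
    obtain ⟨k, rfl⟩ := f.surjective x
    have h := (hconst (k + n)).trans (hconst k).symm
    rw [hf.add_natCast, signedVec_flip, inner_neg_left] at h
    exact self_eq_neg.1 h.symm
  ext i
  simpa [signedVec, EuclideanSpace.inner_single_left] using hzero (i, 1)

theorem fst_eq_iff (hf : IsPolygonLabelling c f) {k l : ZMod (2 * n)} :
    (f k).1 = (f l).1 ↔ k = l ∨ k = l + n := by
  rw [TypeB.fst_eq_iff, ← hf.add_natCast, f.apply_eq_iff_eq, f.apply_eq_iff_eq]

theorem fst_add_right_eq_iff (hf : IsPolygonLabelling c f) {k l : ZMod (2 * n)}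
    (a : ZMod (2 * n)) : (f (k + a)).1 = (f (l + a)).1 ↔ (f k).1 = (f l).1 := by
  rw [hf.fst_eq_iff, hf.fst_eq_iff, add_right_comm, add_left_inj, add_left_inj]

theorem fst_add_ne (hf : IsPolygonLabelling c f) (k : ZMod (2 * n)) {i j : ℕ} (h : i < j)
    (h' : j < i + n) : (f (k + i)).1 ≠ (f (k + j)).1 := by
  rw [Ne, hf.fst_eq_iff, add_assoc, add_right_inj, add_right_inj, ← Nat.cast_add,
    ZMod.natCast_eq_natCast_iff, ZMod.natCast_eq_natCast_iff, Nat.modEq_iff_dvd' h.le,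
    Nat.modEq_iff_dvd' (by omega)]
  rintro (hdvd | hdvd) <;> have := Nat.le_of_dvd (by omega) hdvd <;> omega

theorem fst_ne_fst_add (hf : IsPolygonLabelling c f) (k : ZMod (2 * n)) {m : ℕ} (h : 1 ≤ m)
    (h' : m < n) : (f k).1 ≠ (f (k + m)).1 := by
  simpa using hf.fst_add_ne k (i := 0) h (by omega)

theorem fst_ne_fst_add_one (hf : IsPolygonLabelling c f) (hn : 2 ≤ n) (k : ZMod (2 * n)) :
    (f k).1 ≠ (f (k + 1)).1 := by
  simpa using hf.fst_ne_fst_add k le_rfl hn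

theorem fst_ne_fst_add_two (hf : IsPolygonLabelling c f) (hn : 3 ≤ n) (k : ZMod (2 * n)) :
    (f k).1 ≠ (f (k + 1 + 1)).1 := by
  simpa [add_assoc, one_add_one_eq_two] using hf.fst_ne_fst_add k one_le_two hn

/-- The chord between the vertices `k` and `l` of the `2n`-gon. -/
abbrev diagonal (hf : IsPolygonLabelling c f) (k l : ZMod (2 * n)) : NC c :=
  chord hf.movSpace_rep (f k) (f l)

/-- The edge of the `2n`-gon that starts at the vertex `k`, as a non-crossing partition. -/
abbrev edge (hf : IsPolygonLabelling c f) (k : ZMod (2 * n)) : NC c := hf.diagonal k (k + 1)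

/-- The diameter of the `2n`-gon through the vertex `k`, as a non-crossing partition. -/
abbrev diameter (hf : IsPolygonLabelling c f) (k : ZMod (2 * n)) : NC c :=
  chord hf.movSpace_rep (f k) (flip (f k))

theorem edge_eq_of_fst_eq (hf : IsPolygonLabelling c f) {k l : ZMod (2 * n)}
    (h : (f k).1 = (f l).1) : hf.edge k = hf.edge l := by
  rcases hf.fst_eq_iff.1 h with rfl | rfl
  · rfl
  · rw [edge, diagonal, add_right_comm, hf.add_natCast, hf.add_natCast, chord_flip]

theorem diameter_eq_of_fst_eq (hf : IsPolygonLabelling c f) {k l : ZMod (2 * n)}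
    (h : (f k).1 = (f l).1) : hf.diameter k = hf.diameter l := by
  rcases TypeB.fst_eq_iff.1 h with h | h
  · rw [diameter, h]
  · rw [diameter, h, flip_flip, chord_comm]

theorem exists_eq_diagonal_or_diameter (hf : IsPolygonLabelling c f) {a : NC c}
    (ha : a.rank = 1) :
    (∃ (k : ZMod (2 * n)) (m : ℕ), 1 ≤ m ∧ m < n ∧ a = hf.diagonal k (k + m)) ∨
      ∃ k, a = hf.diameter k := by
  have hsmall (p q : ZMod (2 * n)) (hpq : p ≠ q) (hle : (q - p).val ≤ n) :
      (∃ (k : ZMod (2 * n)) (m : ℕ), 1 ≤ m ∧ m < n ∧ hf.diagonal p q = hf.diagonal k (k + m)) ∨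
        ∃ k, hf.diagonal p q = hf.diameter k := by
    have hq : q = p + (q - p).val := by rw [ZMod.natCast_zmod_val, add_sub_cancel]
    have hpos : (q - p).val ≠ 0 := (ZMod.val_ne_zero _).2 (sub_ne_zero.2 hpq.symm)
    rcases hle.lt_or_eq with hlt | heq
    · exact Or.inl ⟨p, _, Nat.one_le_iff_ne_zero.2 hpos, hlt, congrArg _ hq⟩
    · rw [heq] at hq
      exact Or.inr ⟨p, by rw [hq, diameter, ← hf.add_natCast]⟩
  obtain ⟨x, y, hxy, rfl⟩ := exists_eq_chord hf.movSpace_rep ha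
  obtain ⟨p, rfl⟩ := f.surjective x
  obtain ⟨q, rfl⟩ := f.surjective y
  have hpq : p ≠ q := ne_of_apply_ne f hxy
  rcases le_total (q - p).val n with hle | hle
  · exact hsmall p q hpq hle
  · rw [chord_comm]
    refine hsmall q p hpq.symm ?_
    rw [← neg_sub q p, ZMod.neg_val' (q - p)]
    exact (Nat.mod_le _ _).trans (by omega)

theorem coplanar_edge_diagonal (hf : IsPolygonLabelling c f) (hn : 2 ≤ n) (k : ZMod (2 * n))
    {x y : SignedIndex n} (hxy : x ≠ y) :
    NC.Coplanar {hf.edge k, chord hf.movSpace_rep x y} := by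
  have h := hf.fst_ne_fst_add_one hn k
  rw [edge, diagonal]
  rw [hf k] at h ⊢
  exact coplanar_edge hf.movSpace_rep h hxy

/-- Minus the sum of the vectors of the vertices `k`, `k + 1`, …, `k + m - 1`, the preimage under
`c - 1` of the root of the diagonal from `k` to `k + m`. -/
noncomputable def arcVec (f : ZMod (2 * n) ≃ SignedIndex n) (k : ZMod (2 * n)) (m : ℕ) :
    EuclideanSpace ℝ (Fin n) := -∑ j ∈ Finset.range m, signedVec (f (k + j))

omit [NeZero n] in
theorem rep_arcVec_sub (hf : IsPolygonLabelling c f) (k : ZMod (2 * n)) (m : ℕ) :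
    rep c (arcVec f k m) - arcVec f k m = signedVec (f k) - signedVec (f (k + m)) := by
  have hstep (j : ℕ) : rep c (signedVec (f (k + j))) = signedVec (f (k + (j + 1 : ℕ))) := by
    rw [rep_signedVec, ← hf, Nat.cast_add, Nat.cast_one, add_assoc]
  rw [arcVec, map_neg, neg_sub_neg, map_sum, Finset.sum_congr rfl fun j _ => hstep j,
    ← Finset.sum_sub_distrib,
    Finset.sum_range_sub' (fun j : ℕ => signedVec (f (k + (j : ZMod (2 * n))))) m, Nat.cast_zero,
    add_zero]

theorem inner_arcVec (hf : IsPolygonLabelling c f) (k : ZMod (2 * n)) {i m : ℕ} (hi : i ≤ m)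
    (hm : m < n) : inner ℝ (signedVec (f (k + i))) (arcVec f k m) = if i < m then -1 else 0 := by
  have hinner (j : ℕ) (hj : j ∈ Finset.range m) :
      inner ℝ (signedVec (f (k + i))) (signedVec (f (k + j))) = if i = j then (1 : ℝ) else 0 := by
    rw [Finset.mem_range] at hj
    rcases lt_trichotomy i j with h | rfl | h
    · rw [inner_signedVec_of_fst_ne (hf.fst_add_ne k h (by omega)), if_neg h.ne]
    · rw [inner_signedVec_self, if_pos rfl]
    · rw [inner_signedVec_of_fst_ne (hf.fst_add_ne k h (by omega)).symm, if_neg h.ne']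
  rw [arcVec, inner_neg_right, inner_sum, Finset.sum_congr rfl hinner, Finset.sum_ite_eq, neg_ite,
    neg_zero]
  simp only [Finset.mem_range]

theorem not_coplanar_diagonal_diameter (hf : IsPolygonLabelling c f) (k : ZMod (2 * n)) {m : ℕ}
    (hm : 2 ≤ m) (hmn : m < n) :
    ¬NC.Coplanar {hf.diagonal k (k + m), hf.diameter (k + 1)} := by
  have h1m : (f (k + 1)).1 ≠ (f (k + m)).1 := by
    simpa using hf.fst_add_ne k (i := 1) hm (by omega)
  refine not_coplanar_chord_diameter hf.movSpace_rep (hf.fst_ne_fst_add_one (by omega) k)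
    (hf.fst_ne_fst_add k (by omega) hmn) h1m (hf.rep_arcVec_sub k m) ?_ ?_ ?_
  · simpa [show 0 < m by omega] using hf.inner_arcVec k (Nat.zero_le m) hmn
  · simpa [show 1 < m by omega] using hf.inner_arcVec k (i := 1) (by omega) hmn
  · simpa using hf.inner_arcVec k le_rfl hmn

theorem exists_eq_edge_of_coplanar (hf : IsPolygonLabelling c f) (hn : 3 ≤ n) {a : NC c}
    (ha : a.rank = 1) (h : ∀ b : NC c, b.rank = 1 → NC.Coplanar {a, b}) :
    ∃ k, a = hf.edge k := by
  rcases hf.exists_eq_diagonal_or_diameter ha with ⟨k, m, hm, hmn, rfl⟩ | ⟨k, rfl⟩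
  · rcases hm.eq_or_lt with rfl | hm
    · exact ⟨k, by rw [Nat.cast_one]⟩
    · exact absurd (h (hf.diameter (k + 1)) (chord_rank _ (flip_ne _).symm))
        (hf.not_coplanar_diagonal_diameter k hm hmn)
  · have hne := hf.fst_ne_fst_add (k - 1) one_le_two hn
    have hcop := h _ (chord_rank hf.movSpace_rep (ne_of_apply_ne Prod.fst hne))
    have hnot := hf.not_coplanar_diagonal_diameter (k - 1) le_rfl hn
    rw [sub_add_cancel, Set.pair_comm] at hnot
    exact absurd hcop hnot

end IsPolygonLabelling

end Diagonals

section EdgeAction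

variable {n : ℕ} [NeZero n] {c : W n} {f : ZMod (2 * n) ≃ SignedIndex n}

namespace IsPolygonLabelling

theorem edge_rank (hf : IsPolygonLabelling c f) (hn : 2 ≤ n) (k : ZMod (2 * n)) :
    (hf.edge k).rank = 1 :=
  chord_rank _ (ne_of_apply_ne Prod.fst (hf.fst_ne_fst_add_one hn k))

theorem edge_ne_of_fst_ne (hf : IsPolygonLabelling c f) (hn : 2 ≤ n) {k : ZMod (2 * n)}
    {x y : SignedIndex n} (hx : (f k).1 ≠ x.1) (hy : (f k).1 ≠ y.1) :
    hf.edge k ≠ chord hf.movSpace_rep x y := fun h =>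
  (fst_eq_or_fst_eq_of_chord_eq _ (ne_of_apply_ne Prod.fst (hf.fst_ne_fst_add_one hn k)) h).elim
    hx hy

theorem edge_ne_edge_add_one (hf : IsPolygonLabelling c f) (hn : 3 ≤ n) (k : ZMod (2 * n)) :
    hf.edge k ≠ hf.edge (k + 1) :=
  hf.edge_ne_of_fst_ne (by omega) (hf.fst_ne_fst_add_one (by omega) k) (hf.fst_ne_fst_add_two hn k)

theorem edge_ne_edge_add_two (hf : IsPolygonLabelling c f) (hn : 3 ≤ n) (k : ZMod (2 * n)) :
    hf.edge (k + 1 + 1) ≠ hf.edge k :=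
  hf.edge_ne_of_fst_ne (by omega) (hf.fst_ne_fst_add_two hn k).symm
    (hf.fst_ne_fst_add_one (by omega) (k + 1)).symm

theorem exists_apply_edge_eq (hf : IsPolygonLabelling c f) (hn : 3 ≤ n) (φ : NC c ≃o NC c)
    (k : ZMod (2 * n)) : ∃ l, φ (hf.edge k) = hf.edge l := by
  refine hf.exists_eq_edge_of_coplanar hn (by rw [NC.rank_apply, hf.edge_rank (by omega)]) ?_
  intro b hb
  obtain ⟨x, y, hxy, he⟩ := exists_eq_chord hf.movSpace_rep
    (a := φ.symm b) (by rw [NC.rank_apply, hb])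
  rw [← φ.apply_symm_apply b, he]
  exact (hf.coplanar_edge_diagonal (by omega) k hxy).apply_pair φ

theorem edge_eq_of_coplanar (hf : IsPolygonLabelling c f) (hn : 2 ≤ n) {k l : ZMod (2 * n)}
    {d : NC c} (h : NC.Coplanar {hf.edge k, hf.edge l, d}) (hd : d.rank = 1)
    (hkl : hf.edge k ≠ hf.edge l) (hdk : d ≠ hf.edge k) (hdl : d ≠ hf.edge l) :
    hf.edge l = hf.edge (k + 1) ∨ hf.edge l = hf.edge (k - 1) := by
  by_contra! hadj
  have hk_l := mt hf.edge_eq_of_fst_eq hkl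
  have hk_l1 : (f k).1 ≠ (f (l + 1)).1 := fun he =>
    hadj.2 <| hf.edge_eq_of_fst_eq <| (hf.fst_add_right_eq_iff 1).1 <| by rw [sub_add_cancel, he]
  have hk1_l : (f (k + 1)).1 ≠ (f l).1 := fun he => hadj.1 (hf.edge_eq_of_fst_eq he.symm)
  have hk1_l1 : (f (k + 1)).1 ≠ (f (l + 1)).1 := mt (hf.fst_add_right_eq_iff 1).1 hk_l
  exact (eq_chord_of_coplanar_of_disjoint hf.movSpace_rep (hf.fst_ne_fst_add_one hn k) hk_l hk1_l
    hk_l1 hk1_l1 (hf.fst_ne_fst_add_one hn l) hd h).elim hdk hdl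

theorem apply_edge_add_one (hf : IsPolygonLabelling c f) (hn : 3 ≤ n) (φ : NC c ≃o NC c)
    {k l : ZMod (2 * n)} (h : φ (hf.edge k) = hf.edge l) :
    φ (hf.edge (k + 1)) = hf.edge (l + 1) ∨ φ (hf.edge (k + 1)) = hf.edge (l - 1) := by
  obtain ⟨l', hl'⟩ := hf.exists_apply_edge_eq hn φ (k + 1)
  have h01 := hf.fst_ne_fst_add_one (by omega) k
  have h12 := hf.fst_ne_fst_add_one (by omega) (k + 1)
  have h02 := hf.fst_ne_fst_add_two hn k
  have hcop := coplanar_chord_trans hf.movSpace_rep h01 h12 h02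
    (hf.coplanar_edge_diagonal (by omega) k (ne_of_apply_ne Prod.fst h12))
  have himage := hcop.apply_triple φ
  rw [h, hl'] at himage
  have hne02 := ne_of_apply_ne Prod.fst h02
  rw [hl']
  refine hf.edge_eq_of_coplanar (by omega) himage
    (by rw [NC.rank_apply, chord_rank _ hne02]) ?_ ?_ ?_
  · rw [← h, ← hl']
    exact φ.injective.ne (hf.edge_ne_edge_add_one hn k)
  · rw [← h]
    refine φ.injective.ne fun he => ?_
    rw [chord_comm] at he
    exact (fst_eq_or_fst_eq_of_chord_eq _ hne02.symm he).elim h02.symm h12.symm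
  · rw [← hl']
    exact φ.injective.ne fun he => (fst_eq_or_fst_eq_of_chord_eq _ hne02 he).elim h01 h02

theorem apply_edge_of_add (hf : IsPolygonLabelling c f) (hn : 3 ≤ n) {φ : NC c ≃o NC c}
    {a : ZMod (2 * n)} (h0 : φ (hf.edge 0) = hf.edge a) (h1 : φ (hf.edge 1) = hf.edge (a + 1))
    (k : ZMod (2 * n)) : φ (hf.edge k) = hf.edge (a + k) := by
  suffices h : φ (hf.edge k) = hf.edge (a + k) ∧ φ (hf.edge (k + 1)) = hf.edge (a + k + 1) from h.1
  induction k using zmod_induction with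
  | zero => simpa only [zero_add, add_zero] using And.intro h0 h1
  | add_one k ih =>
    rw [← add_assoc]
    refine ⟨ih.2, (hf.apply_edge_add_one hn φ ih.2).resolve_right fun h => ?_⟩
    rw [add_sub_cancel_right, ← ih.1] at h
    exact hf.edge_ne_edge_add_two hn k (φ.injective h)

theorem apply_edge_of_sub (hf : IsPolygonLabelling c f) (hn : 3 ≤ n) {φ : NC c ≃o NC c}
    {a : ZMod (2 * n)} (h0 : φ (hf.edge 0) = hf.edge a) (h1 : φ (hf.edge 1) = hf.edge (a - 1))
    (k : ZMod (2 * n)) : φ (hf.edge k) = hf.edge (a - k) := by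
  suffices h : φ (hf.edge k) = hf.edge (a - k) ∧ φ (hf.edge (k + 1)) = hf.edge (a - k - 1) from h.1
  induction k using zmod_induction with
  | zero => simpa only [zero_add, sub_zero] using And.intro h0 h1
  | add_one k ih =>
    rw [← sub_sub]
    refine ⟨ih.2, (hf.apply_edge_add_one hn φ ih.2).resolve_left fun h => ?_⟩
    rw [sub_add_cancel, ← ih.1] at h
    exact hf.edge_ne_edge_add_two hn k (φ.injective h)

theorem exists_apply_edge_eq_add_or_sub (hf : IsPolygonLabelling c f) (hn : 3 ≤ n)
    (φ : NC c ≃o NC c) : ∃ a, (∀ k, φ (hf.edge k) = hf.edge (a + k)) ∨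
      ∀ k, φ (hf.edge k) = hf.edge (a - k) := by
  obtain ⟨a, ha⟩ := hf.exists_apply_edge_eq hn φ 0
  have h := hf.apply_edge_add_one hn φ ha
  rw [zero_add] at h
  exact ⟨a, h.imp (hf.apply_edge_of_add hn ha) (hf.apply_edge_of_sub hn ha)⟩

theorem apply_diagonal_of_apply_edge (hf : IsPolygonLabelling c f) {φ : NC c ≃o NC c}
    (h : ∀ k, φ (hf.edge k) = hf.edge k) (k : ZMod (2 * n)) {m : ℕ} (hm : 1 ≤ m) (hmn : m < n) :
    φ (hf.diagonal k (k + m)) = hf.diagonal k (k + m) := by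
  induction m, hm using Nat.le_induction with
  | base => rw [Nat.cast_one, h]
  | succ m hm ih =>
    have hxy := hf.fst_ne_fst_add k hm (by omega)
    have hyz := hf.fst_ne_fst_add_one (by omega) (k + m)
    have hxz := hf.fst_ne_fst_add k (by omega) hmn
    rw [Nat.cast_add, Nat.cast_one, ← add_assoc] at hxz ⊢
    have hxz' := ne_of_apply_ne Prod.fst hxz
    have hedge := hf.coplanar_edge_diagonal (by omega) (k + m) (ne_of_apply_ne Prod.fst hxy)
    rw [Set.pair_comm] at hedge
    have himage := (coplanar_chord_trans hf.movSpace_rep hxy hyz hxz hedge).apply_triple φ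
    rw [ih (by omega), h] at himage
    rcases eq_chord_of_coplanar_chain hf.movSpace_rep hxy hxz hyz
      (by rw [NC.rank_apply, chord_rank _ hxz']) himage with he | he | he
    · have he := φ.injective (he.trans (ih (by omega)).symm)
      rw [chord_comm] at he
      exact ((fst_eq_or_fst_eq_of_chord_eq _ hxz'.symm he).elim hxz.symm hyz.symm).elim
    · have he := φ.injective (he.trans (h _).symm)
      exact ((fst_eq_or_fst_eq_of_chord_eq _ hxz' he).elim hxy hxz).elim
    · exact he

theorem coplanar_diagonal_diameter (hf : IsPolygonLabelling c f) (hn : 3 ≤ n) {k l : ZMod (2 * n)}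
    (hl : (f (k + 1)).1 ≠ (f l).1) : NC.Coplanar {hf.diagonal k (k + 2), hf.diameter l} := by
  have hkk := hf.fst_ne_fst_add k one_le_two hn
  rw [Nat.cast_two] at hkk
  have hdiag := ne_of_apply_ne Prod.fst hkk
  have h1 : (f (k + 1)).1 ≠ (f (k + 2)).1 := by
    simpa using hf.fst_add_ne k (i := 1) (j := 2) (by omega) (by omega)
  have hcop {l : ZMod (2 * n)} (hl : (f (k + 1)).1 ≠ (f l).1) (hkl : (f k).1 ≠ (f l).1) :
      NC.Coplanar {hf.diagonal k (k + 2), hf.diameter l} := by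
    refine coplanar_chord_of_inner_eq_zero hf.movSpace_rep hdiag (flip_ne _).symm
      (u := arcVec f k 2) (by rw [hf.rep_arcVec_sub, Nat.cast_two]) ?_
    rw [arcVec, Finset.sum_range_succ, Finset.sum_range_one, Nat.cast_zero, add_zero, Nat.cast_one,
      inner_neg_left, inner_add_left,
      inner_signedVec_sub_of_fst_ne hkl (q := flip (f l)) hkl,
      inner_signedVec_sub_of_fst_ne hl (q := flip (f l)) hl, add_zero, neg_zero]
  by_cases hkl : (f k).1 = (f l).1
  · rw [← hf.diameter_eq_of_fst_eq hkl]
    have hne : hf.diagonal k (k + 2) ≠ hf.diameter (k + 2) := fun h =>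
      (fst_eq_or_fst_eq_of_chord_eq _ hdiag h).elim hkk hkk
    obtain ⟨w, hw, hle⟩ := (coplanar_chord_iff hf.movSpace_rep hdiag (flip_ne _).symm hne
      (r := f k) (s := flip (f k))).2
        ⟨hcop h1 hkk, 2, 1, by rw [signedVec_flip, signedVec_flip]; module⟩
    exact ⟨w, hw, fun a ha => hle a (by grind)⟩
  · exact hcop hl hkl

theorem apply_diameter_of_apply_diagonal (hf : IsPolygonLabelling c f) (hn : 3 ≤ n)
    {φ : NC c ≃o NC c}
    (h : ∀ k (m : ℕ), 1 ≤ m → m < n → φ (hf.diagonal k (k + m)) = hf.diagonal k (k + m))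
    (k : ZMod (2 * n)) : φ (hf.diameter k) = hf.diameter k := by
  rcases hf.exists_eq_diagonal_or_diameter
    (a := φ (hf.diameter k)) (by rw [NC.rank_apply, chord_rank _ (flip_ne _).symm])
    with ⟨p, m, hm, hmn, he⟩ | ⟨l, he⟩
  · rw [he, ← φ.injective.eq_iff, he, h p m hm hmn]
  · suffices hkl : (f k).1 = (f l).1 by rw [he, hf.diameter_eq_of_fst_eq hkl]
    by_contra hkl
    have hcop := hf.coplanar_diagonal_diameter hn (k := k - 1) (l := l) (by rwa [sub_add_cancel])
    have hfix := h (k - 1) 2 one_le_two hn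
    rw [Nat.cast_two] at hfix
    rw [← hfix, ← he] at hcop
    have hnot := hf.not_coplanar_diagonal_diameter (k - 1) le_rfl hn
    rw [sub_add_cancel, Nat.cast_two] at hnot
    have hback := hcop.apply_pair φ.symm
    rw [φ.symm_apply_apply, φ.symm_apply_apply] at hback
    exact hnot hback

theorem eq_one_of_apply_edge (hf : IsPolygonLabelling c f) (hn : 3 ≤ n) {φ : NC c ≃o NC c}
    (h : ∀ k, φ (hf.edge k) = hf.edge k) : φ = 1 := by
  have hdiag := fun k m => hf.apply_diagonal_of_apply_edge h k (m := m)
  refine NC.eq_one_of_forall_rank_one hf.movSpace_rep fun a ha => ?_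
  rcases hf.exists_eq_diagonal_or_diameter ha with ⟨k, m, hm, hmn, rfl⟩ | ⟨k, rfl⟩
  · exact hdiag k m hm hmn
  · exact hf.apply_diameter_of_apply_diagonal hn hdiag k

end IsPolygonLabelling

end EdgeAction

section DihedralGroup

variable {m n : ℕ}

theorem polygonAct_r (i k : ZMod m) : polygonAct (.r i) k = k + i := rfl

theorem polygonAct_sr (i k : ZMod m) : polygonAct (.sr i) k = -(k + i) := rfl

theorem polygonAct_one (k : ZMod m) : polygonAct 1 k = k := add_zero k

theorem polygonAct_mul (g h : DihedralGroup m) (k : ZMod m) :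
    polygonAct (g * h) k = polygonAct g (polygonAct h k) := by
  rcases g with i | i <;> rcases h with j | j <;>
    simp only [DihedralGroup.r_mul_r, DihedralGroup.r_mul_sr, DihedralGroup.sr_mul_r,
      DihedralGroup.sr_mul_sr, polygonAct_r, polygonAct_sr] <;> ring

theorem polygonAct_add_natCast (g : DihedralGroup (2 * n)) (k : ZMod (2 * n)) :
    polygonAct g (k + n) = polygonAct g k + n := by
  rcases g with i | i
  · rw [polygonAct_r, polygonAct_r, add_right_comm]
  · have hn : (n : ZMod (2 * n)) + n = 0 := by
      rw [← Nat.cast_add, ← two_mul, ZMod.natCast_self]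
    rw [polygonAct_sr, polygonAct_sr]
    linear_combination -hn

/-- The action of the dihedral group on the vertices of the polygon, as a homomorphism. -/
def polygonPerm (m : ℕ) : DihedralGroup m →* Equiv.Perm (ZMod m) :=
  MonoidHom.toHomPerm
    { toFun := polygonAct
      map_one' := funext polygonAct_one
      map_mul' := fun g h => funext (polygonAct_mul g h) }

theorem closure_pair_sr_eq_top (b : ZMod m) :
    Subgroup.closure {DihedralGroup.sr b, DihedralGroup.sr (b + 1)} = ⊤ := by
  set H := Subgroup.closure {DihedralGroup.sr b, DihedralGroup.sr (b + 1)}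
  have hb : DihedralGroup.sr b ∈ H := Subgroup.subset_closure (Set.mem_insert _ _)
  have hb' : DihedralGroup.sr (b + 1) ∈ H := Subgroup.subset_closure (Set.mem_insert_of_mem _ rfl)
  have hr (i : ZMod m) : DihedralGroup.r i ∈ H := by
    have hone := H.mul_mem hb hb'
    rw [DihedralGroup.sr_mul_sr, add_sub_cancel_left] at hone
    obtain ⟨j, rfl⟩ := ZMod.intCast_surjective i
    rw [← DihedralGroup.r_one_zpow]
    exact H.zpow_mem hone j
  refine Subgroup.eq_top_iff' H |>.2 fun g => ?_
  rcases g with i | i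
  · exact hr i
  · rw [← add_sub_cancel b i, ← DihedralGroup.sr_mul_r]
    exact H.mul_mem hb (hr _)

/-- The quotient map from the symmetries of the `2n`-gon to the symmetries of the `n`-gon, shifted
so that the reflection `sr b` goes to `sr 0`. -/
def dihedralQuotient (b : ZMod (2 * n)) : DihedralGroup (2 * n) →* DihedralGroup n where
  toFun
    | .r i => .r (ZMod.castHom (dvd_mul_left n 2) (ZMod n) i)
    | .sr i => .sr (ZMod.castHom (dvd_mul_left n 2) (ZMod n) (i - b))
  map_one' := congrArg DihedralGroup.r (map_zero _)
  map_mul' g h := by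
    rcases g with i | i <;> rcases h with j | j <;>
      simp only [DihedralGroup.r_mul_r, DihedralGroup.r_mul_sr, DihedralGroup.sr_mul_r,
        DihedralGroup.sr_mul_sr, map_add, map_sub] <;>
      congr 1 <;> ring

theorem dihedralQuotient_sr (b i : ZMod (2 * n)) : dihedralQuotient b (.sr i) =
    .sr (ZMod.castHom (dvd_mul_left n 2) (ZMod n) (i - b)) := rfl

theorem dihedralQuotient_surjective (b : ZMod (2 * n)) :
    Function.Surjective (dihedralQuotient b) := by
  have hs := ZMod.castHom_surjective (dvd_mul_left n 2)
  rintro (i | i)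
  · obtain ⟨j, rfl⟩ := hs i
    exact ⟨.r j, rfl⟩
  · obtain ⟨j, rfl⟩ := hs i
    exact ⟨.sr (j + b), by rw [dihedralQuotient_sr, add_sub_cancel_right]⟩

theorem castHom_eq_zero_iff [NeZero n] {i : ZMod (2 * n)} :
    ZMod.castHom (dvd_mul_left n 2) (ZMod n) i = 0 ↔ i = 0 ∨ i = n := by
  constructor
  · intro hi
    rw [← ZMod.natCast_zmod_val i, map_natCast, ZMod.natCast_eq_zero_iff] at hi
    obtain ⟨q, hq⟩ := hi
    have hlt : n * q < n * 2 := by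
      rw [← hq, mul_comm n]
      exact ZMod.val_lt i
    have hq2 := Nat.lt_of_mul_lt_mul_left hlt
    rw [← ZMod.natCast_zmod_val i, hq]
    interval_cases q
    · exact .inl (by rw [mul_zero, Nat.cast_zero])
    · exact .inr (by rw [mul_one])
  · rintro (rfl | rfl)
    · exact map_zero _
    · rw [map_natCast, ZMod.natCast_self]

theorem dihedralQuotient_ker [NeZero n] (b : ZMod (2 * n)) :
    (dihedralQuotient b).ker = Subgroup.zpowers (DihedralGroup.r (n : ZMod (2 * n))) := by
  apply le_antisymm
  · rintro (i | i) hg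
    · rcases castHom_eq_zero_iff.1 (DihedralGroup.r.inj hg) with rfl | rfl
      · exact Subgroup.one_mem _
      · exact Subgroup.mem_zpowers _
    · cases hg
  · rw [Subgroup.zpowers_le]
    exact congrArg DihedralGroup.r (castHom_eq_zero_iff.2 (.inr rfl))

theorem exists_mulEquiv_of_ker_eq {G H K : Type*} [Group G] [Group H] [Group K] {α : G →* H}
    {β : G →* K} (hα : Function.Surjective α) (hβ : Function.Surjective β) (h : α.ker = β.ker) :
    ∃ e : H ≃* K, ∀ g, e (α g) = β g := by
  refine ⟨(QuotientGroup.liftEquiv _ hα rfl).symm.trans (QuotientGroup.liftEquiv _ hβ h),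
    fun g => ?_⟩
  rw [MulEquiv.trans_apply, ← QuotientGroup.liftEquiv_mk _ hα rfl, MulEquiv.symm_apply_apply]
  rfl

end DihedralGroup

section Automorphisms

variable {n : ℕ} {c : W n}

theorem absLength_conj (u w : W n) : absLength (u * w * u⁻¹) = absLength w := by
  rw [absLength_eq_movRank, absLength_eq_movRank, map_mul, map_mul, map_inv, movRank_conj]

theorem absLength_inv (w : W n) : absLength w⁻¹ = absLength w := by
  rw [absLength_eq_movRank, absLength_eq_movRank, map_inv, movRank_inv]

theorem absLE_conj_iff (u : W n) {v w : W n} :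
    AbsLE (u * v * u⁻¹) (u * w * u⁻¹) ↔ AbsLE v w := by
  have hdiff : (u * v * u⁻¹)⁻¹ * (u * w * u⁻¹) = u * (v⁻¹ * w) * u⁻¹ := by group
  rw [AbsLE, AbsLE, hdiff, absLength_conj, absLength_conj, absLength_conj]

theorem absLE_inv_iff {v w : W n} : AbsLE v⁻¹ w⁻¹ ↔ AbsLE v w := by
  have hdiff : v⁻¹⁻¹ * w⁻¹ = v * (v⁻¹ * w)⁻¹ * v⁻¹ := by group
  rw [AbsLE, AbsLE, hdiff, absLength_conj, absLength_inv, absLength_inv, absLength_inv]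

/-- Conjugation by an element that commutes with `c`. -/
def conjAut (u : W n) (h : u * c * u⁻¹ = c) : NC c ≃o NC c where
  toEquiv := (MulAut.conj u).toEquiv.subtypeEquiv fun w => by
    conv_rhs => rw [← h]
    exact (absLE_conj_iff u).symm
  map_rel_iff' := absLE_conj_iff u

/-- Inversion followed by conjugation by an element that conjugates `c⁻¹` to `c`. -/
def conjInvAut (u : W n) (h : u * c⁻¹ * u⁻¹ = c) : NC c ≃o NC c where
  toEquiv := ((Equiv.inv (W n)).trans (MulAut.conj u).toEquiv).subtypeEquiv fun w => by
    conv_rhs => rw [← h]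
    exact ((absLE_conj_iff u).trans absLE_inv_iff).symm
  map_rel_iff' := (absLE_conj_iff u).trans absLE_inv_iff

end Automorphisms

section PolygonAction

variable {n : ℕ} [NeZero n] {c : W n} {f : ZMod (2 * n) ≃ SignedIndex n}

theorem IsPolygonLabelling.symm_flip (hf : IsPolygonLabelling c f) (x : SignedIndex n) :
    f.symm (flip x) = f.symm x + n := by
  rw [Equiv.symm_apply_eq, hf.add_natCast, Equiv.apply_symm_apply]

variable (hf : IsPolygonLabelling c f)

/-- The symmetries of the polygon as signed permutations of its labels. -/
def polygonHom : DihedralGroup (2 * n) →* W n :=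
  (f.permCongrHom.toMonoidHom.comp (polygonPerm (2 * n))).codRestrict (signedPerms n) fun g x => by
    change f (polygonAct g (f.symm (flip x))) = flip (f (polygonAct g (f.symm x)))
    rw [hf.symm_flip, polygonAct_add_natCast, hf.add_natCast]

theorem polygonHom_apply (g : DihedralGroup (2 * n)) (k : ZMod (2 * n)) :
    (polygonHom hf g).1 (f k) = f (polygonAct g k) :=
  congrArg (fun j => f (polygonAct g j)) (f.symm_apply_apply k)

theorem eq_polygonHom {w : W n} {g : DihedralGroup (2 * n)}
    (h : ∀ k, w.1 (f k) = f (polygonAct g k)) : w = polygonHom hf g :=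
  Subtype.ext <| Equiv.ext <| f.surjective.forall.2 fun k => by rw [h, polygonHom_apply]

theorem polygonHom_r_one : polygonHom hf (.r 1) = c :=
  (eq_polygonHom hf fun k => (hf k).symm).symm

theorem polygonHom_r_conj (i : ZMod (2 * n)) :
    polygonHom hf (.r i) * c * (polygonHom hf (.r i))⁻¹ = c := by
  have hconj : .r i * .r 1 * (.r i)⁻¹ = DihedralGroup.r (1 : ZMod (2 * n)) := by simp
  simpa only [map_mul, map_inv, polygonHom_r_one] using congrArg (polygonHom hf) hconj

theorem polygonHom_sr_conj_inv (i : ZMod (2 * n)) :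
    polygonHom hf (.sr i) * c⁻¹ * (polygonHom hf (.sr i))⁻¹ = c := by
  have hconj : .sr i * (.r 1)⁻¹ * (.sr i)⁻¹ = DihedralGroup.r (1 : ZMod (2 * n)) := by simp
  simpa only [map_mul, map_inv, polygonHom_r_one] using congrArg (polygonHom hf) hconj

theorem polygonHom_r_natCast_apply (x : SignedIndex n) :
    (polygonHom hf (.r n)).1 x = flip x := by
  obtain ⟨k, rfl⟩ := f.surjective x
  rw [polygonHom_apply, polygonAct_r, hf.add_natCast]

theorem commute_polygonHom_r_natCast (w : W n) : Commute (polygonHom hf (.r n)) w :=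
  Subtype.ext <| Equiv.ext fun x => by
    change (polygonHom hf (.r n)).1 (w.1 x) = w.1 ((polygonHom hf (.r n)).1 x)
    rw [polygonHom_r_natCast_apply, polygonHom_r_natCast_apply, apply_flip]

/-- The action of the symmetries of the polygon on the non-crossing partitions. A reflection of
the polygon reverses the orientation of the cycles, hence the inverse in `conjInvAut`. -/
def polygonAut : DihedralGroup (2 * n) →* (NC c ≃o NC c) where
  toFun
    | .r i => conjAut (polygonHom hf (.r i)) (polygonHom_r_conj hf i)
    | .sr i => conjInvAut (polygonHom hf (.sr i)) (polygonHom_sr_conj_inv hf i)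
  map_one' := RelIso.ext fun w => Subtype.ext <| by
    change polygonHom hf 1 * w.1 * (polygonHom hf 1)⁻¹ = w.1
    rw [map_one, one_mul, inv_one, mul_one]
  map_mul' g h := by
    refine RelIso.ext fun w => Subtype.ext ?_
    rcases g with i | i <;> rcases h with j | j
    · change polygonHom hf (.r i * .r j) * w.1 * (polygonHom hf (.r i * .r j))⁻¹ =
        polygonHom hf (.r i) * (polygonHom hf (.r j) * w.1 * (polygonHom hf (.r j))⁻¹) *
          (polygonHom hf (.r i))⁻¹
      rw [map_mul]; group
    · change polygonHom hf (.r i * .sr j) * w.1⁻¹ * (polygonHom hf (.r i * .sr j))⁻¹ =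
        polygonHom hf (.r i) * (polygonHom hf (.sr j) * w.1⁻¹ * (polygonHom hf (.sr j))⁻¹) *
          (polygonHom hf (.r i))⁻¹
      rw [map_mul]; group
    · change polygonHom hf (.sr i * .r j) * w.1⁻¹ * (polygonHom hf (.sr i * .r j))⁻¹ =
        polygonHom hf (.sr i) * (polygonHom hf (.r j) * w.1 * (polygonHom hf (.r j))⁻¹)⁻¹ *
          (polygonHom hf (.sr i))⁻¹
      rw [map_mul]; group
    · change polygonHom hf (.sr i * .sr j) * w.1 * (polygonHom hf (.sr i * .sr j))⁻¹ =
        polygonHom hf (.sr i) * (polygonHom hf (.sr j) * w.1⁻¹ * (polygonHom hf (.sr j))⁻¹)⁻¹ *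
          (polygonHom hf (.sr i))⁻¹
      rw [map_mul]; group

theorem polygonAut_r (i : ZMod (2 * n)) (w : NC c) : (polygonAut hf (.r i) w).1 =
    polygonHom hf (.r i) * w.1 * (polygonHom hf (.r i))⁻¹ := rfl

theorem polygonAut_sr (i : ZMod (2 * n)) (w : NC c) : (polygonAut hf (.sr i) w).1 =
    polygonHom hf (.sr i) * w.1⁻¹ * (polygonHom hf (.sr i))⁻¹ := rfl

theorem sameBlock_polygonAut_iff (g : DihedralGroup (2 * n)) (w : NC c) (x y : ZMod (2 * n)) :
    SameBlock f (polygonAut hf g w).1 (polygonAct g x) (polygonAct g y) ↔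
      SameBlock f w.1 x y := by
  rw [SameBlock, SameBlock, ← polygonHom_apply hf, ← polygonHom_apply hf]
  rcases g with i | i
  · rw [polygonAut_r]
    simp only [Subgroup.coe_mul, Subgroup.coe_inv, Equiv.Perm.sameCycle_conj,
      Equiv.Perm.coe_inv, Equiv.symm_apply_apply]
  · rw [polygonAut_sr]
    simp only [Subgroup.coe_mul, Subgroup.coe_inv, Equiv.Perm.sameCycle_conj,
      Equiv.Perm.coe_inv, Equiv.symm_apply_apply, Equiv.Perm.sameCycle_inv]

theorem polygonAut_diagonal (g : DihedralGroup (2 * n)) (p q : ZMod (2 * n)) :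
    polygonAut hf g (hf.diagonal p q) = hf.diagonal (polygonAct g p) (polygonAct g q) := by
  refine Subtype.ext (Eq.trans ?_ ((conj_signedSwap (polygonHom hf g) (f p) (f q)).trans
    (by rw [polygonHom_apply, polygonHom_apply]; rfl)))
  rcases g with i | i
  · rfl
  · exact congrArg (polygonHom hf (.sr i) * · * _) (signedSwap_inv (f p) (f q))

theorem polygonAut_surjective (hn : 3 ≤ n) : Function.Surjective (polygonAut hf) := by
  intro φ
  suffices h : ∃ g, ∀ k, φ (hf.edge k) = polygonAut hf g (hf.edge k) by
    obtain ⟨g, hg⟩ := h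
    refine ⟨g, inv_mul_eq_one.1 (hf.eq_one_of_apply_edge hn fun k => ?_)⟩
    rw [RelIso.mul_apply, hg]
    exact (polygonAut hf g).symm_apply_apply _
  obtain ⟨a, h | h⟩ := hf.exists_apply_edge_eq_add_or_sub hn φ
  · refine ⟨.r a, fun k => ?_⟩
    rw [h, polygonAut_diagonal, polygonAct_r, polygonAct_r, add_right_comm, add_comm a]
  · refine ⟨.sr (-a - 1), fun k => ?_⟩
    have hstart : -(k + (-a - 1)) = a - k + 1 := by ring
    have hend : -(k + 1 + (-a - 1)) = a - k := by ring
    rw [h, polygonAut_diagonal, polygonAct_sr, polygonAct_sr, hstart, hend]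
    exact chord_comm _ _ _

theorem fst_polygonAct_of_polygonAut_eq_one {g : DihedralGroup (2 * n)}
    (hg : polygonAut hf g = 1) (k : ZMod (2 * n)) : (f (polygonAct g k)).1 = (f k).1 := by
  have hdiam := polygonAut_diagonal hf g k (k + n)
  rw [polygonAct_add_natCast, hg] at hdiam
  have hne : f (polygonAct g k) ≠ f (polygonAct g k + n) := by
    rw [hf.add_natCast]
    exact (flip_ne _).symm
  refine (fst_eq_or_fst_eq_of_chord_eq _ hne hdiam.symm).elim id fun h => h.trans ?_
  rw [hf.add_natCast, flip]

theorem polygonAut_ker (hn : 3 ≤ n) :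
    (polygonAut hf).ker = Subgroup.zpowers (DihedralGroup.r (n : ZMod (2 * n))) := by
  apply le_antisymm
  · intro g hg
    have hfst := fst_polygonAct_of_polygonAut_eq_one hf hg
    rcases g with i | i
    · have h0 := hf.fst_eq_iff.1 (hfst 0)
      rw [polygonAct_r, zero_add, zero_add] at h0
      rcases h0 with rfl | rfl
      · exact Subgroup.one_mem _
      · exact Subgroup.mem_zpowers _
    · have h0 := hfst 0
      have h1 := hfst (0 + 1)
      rw [polygonAct_sr] at h0 h1
      rw [← hf.fst_add_right_eq_iff 1, add_right_comm, neg_add, neg_add_cancel_right, h0, eq_comm]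
        at h1
      exact (hf.fst_ne_fst_add_two hn 0 h1.symm).elim
  · rw [Subgroup.zpowers_le, MonoidHom.mem_ker]
    refine RelIso.ext fun w => Subtype.ext ?_
    rw [polygonAut_r, (commute_polygonHom_r_natCast hf w.1).eq, mul_inv_cancel_right]
    rfl

end PolygonAction

section Bipartitions

variable {n : ℕ} {c : W n} {f : ZMod (2 * n) ≃ SignedIndex n}

theorem IsBipartition.mul_left_mul {l r : W n} (h : IsBipartition c l r) : c * l * c = l := by
  obtain ⟨rfl, hl, hr⟩ := h
  rw [pow_two] at hl hr
  calc l * r * l * (l * r) = l * r * (l * l) * r := by group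
    _ = l := by rw [hl, mul_one, mul_assoc, hr, mul_one]

theorem IsBipartition.inv_left {l r : W n} (h : IsBipartition c l r) : l⁻¹ = l :=
  inv_eq_of_mul_eq_one_left ((pow_two l).symm.trans h.2.1)

theorem IsBipartition.inv_right {l r : W n} (h : IsBipartition c l r) : r⁻¹ = r :=
  inv_eq_of_mul_eq_one_left ((pow_two r).symm.trans h.2.2)

variable [NeZero n] (hf : IsPolygonLabelling c f)

theorem IsBipartition.exists_eq_polygonHom {l r : W n} (h : IsBipartition c l r) :
    ∃ b, l = polygonHom hf (.sr b) ∧ r = polygonHom hf (.sr (b + 1)) := by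
  have hreverse (x : SignedIndex n) : c.1 (l.1 (c.1 x)) = l.1 x :=
    congrArg (fun w : W n => w.1 x) h.mul_left_mul
  have hl : l = polygonHom hf (.sr (-f.symm (l.1 (f 0)))) := eq_polygonHom hf fun k => by
    rw [hf.apply_of_reverse hreverse, polygonAct_sr, neg_add_rev, neg_neg, ← sub_eq_add_neg]
  refine ⟨_, hl, ?_⟩
  rw [← DihedralGroup.sr_mul_r, map_mul, polygonHom_r_one, ← hl, h.1, ← mul_assoc, ← pow_two, h.2.1,
    one_mul]

theorem isBipartition_polygonHom_sr (b : ZMod (2 * n)) :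
    IsBipartition c (polygonHom hf (.sr b)) (polygonHom hf (.sr (b + 1))) := by
  refine ⟨?_, ?_, ?_⟩
  · rw [← map_mul, DihedralGroup.sr_mul_sr, add_sub_cancel_left, polygonHom_r_one]
  all_goals rw [pow_two, ← map_mul, DihedralGroup.sr_mul_self, map_one]

theorem exists_mulEquiv_dihedralGroup (hn : 3 ≤ n) (b : ZMod (2 * n)) :
    ∃ e : (NC c ≃o NC c) ≃* DihedralGroup n,
      ∀ g, e (polygonAut hf g) = dihedralQuotient b g :=
  exists_mulEquiv_of_ker_eq (polygonAut_surjective hf hn) (dihedralQuotient_surjective b)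
    ((polygonAut_ker hf hn).trans (dihedralQuotient_ker b).symm)

theorem closure_pair_polygonAut_sr_eq_top (hn : 3 ≤ n) (b : ZMod (2 * n)) :
    Subgroup.closure {polygonAut hf (.sr b), polygonAut hf (.sr (b + 1))} = ⊤ := by
  rw [← Set.image_pair, ← MonoidHom.map_closure, closure_pair_sr_eq_top, ← MonoidHom.range_eq_map,
    MonoidHom.range_eq_top]
  exact polygonAut_surjective hf hn

end Bipartitions

end TypeB

theorem mainTheorem2 (n : ℕ) (hn : 3 ≤ n) (c : TypeB.W n) (hc : TypeB.IsCoxeterElement c) :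
    (∃ l r : TypeB.W n, TypeB.IsBipartition c l r) ∧
    (∀ l r : TypeB.W n, TypeB.IsBipartition c l r →
      ∃ φl φr : TypeB.NC c ≃o TypeB.NC c,
        (∀ w, (φl w).1 = l * w.1⁻¹ * l) ∧
        (∀ w, (φr w).1 = r * w.1⁻¹ * r) ∧
        Subgroup.closure {φl, φr} = ⊤ ∧
        ∃ e : (TypeB.NC c ≃o TypeB.NC c) ≃* DihedralGroup n,
          e φl = DihedralGroup.sr 0 ∧ e φr = DihedralGroup.sr 1) ∧
    Nat.card (TypeB.NC c ≃o TypeB.NC c) = 2 * n ∧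
    (∃ f : ZMod (2 * n) ≃ TypeB.SignedIndex n, TypeB.IsPolygonLabelling c f) ∧
    (∀ f : ZMod (2 * n) ≃ TypeB.SignedIndex n, TypeB.IsPolygonLabelling c f →
      ∃ ρ : DihedralGroup (2 * n) →* (TypeB.NC c ≃o TypeB.NC c),
        Function.Surjective ρ ∧
        ρ.ker = Subgroup.zpowers (DihedralGroup.r (n : ZMod (2 * n))) ∧
        ∀ (g : DihedralGroup (2 * n)) (w : TypeB.NC c) (x y : ZMod (2 * n)),
          TypeB.SameBlock f (ρ g w).1 (TypeB.polygonAct g x) (TypeB.polygonAct g y) ↔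
            TypeB.SameBlock f w.1 x y) := by
  have : NeZero n := ⟨by omega⟩
  obtain ⟨f, hf⟩ := hc.exists_isPolygonLabelling
  refine ⟨⟨_, _, TypeB.isBipartition_polygonHom_sr hf 0⟩, fun l r hlr => ?_, ?_, ⟨f, hf⟩,
    fun f' hf' => ⟨TypeB.polygonAut hf', TypeB.polygonAut_surjective hf' hn,
      TypeB.polygonAut_ker hf' hn, TypeB.sameBlock_polygonAut_iff hf'⟩⟩
  · obtain ⟨b, hl, hr⟩ := hlr.exists_eq_polygonHom hf
    obtain ⟨e, he⟩ := TypeB.exists_mulEquiv_dihedralGroup hf hn b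
    refine ⟨TypeB.polygonAut hf (.sr b), TypeB.polygonAut hf (.sr (b + 1)), fun w => ?_,
      fun w => ?_, TypeB.closure_pair_polygonAut_sr_eq_top hf hn b, e, ?_, ?_⟩
    · rw [TypeB.polygonAut_sr, ← hl, hlr.inv_left]
    · rw [TypeB.polygonAut_sr, ← hr, hlr.inv_right]
    · rw [he, TypeB.dihedralQuotient_sr, sub_self, map_zero]
    · rw [he, TypeB.dihedralQuotient_sr, add_sub_cancel_left, map_one]
  · obtain ⟨e, -⟩ := TypeB.exists_mulEquiv_dihedralGroup hf hn 0
    rw [Nat.card_congr e.toEquiv, DihedralGroup.nat_card]
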